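/- Let $T^*S^6=\{(x,\xi)\in\mathbb R^7\times\mathbb R^7 : \|x\|=1,\ x\cdot\xi=0\}$, and let $\Phi(x,\xi)=\cosh\|\xi\|\,x+\sqrt{-1}\,\frac{\sinh\|\xi\|}{\|\xi\|}\,\xi$ be the diffeomorphism of $T^*S^6$ onto the quadric $Q=\{z\in\mathbb C^7:\sum_i z_i^2=1\}$. Let $c>0$, and let $u$ be a real function, smooth on $[1,\infty)$, such that $U(t)=u(\cosh t)$ satisfies $\frac{d}{dt}\big(U'(t)^6\big)=6c\,(\sinh t)^5$ and $U'(t)>0$ for $t>0$. Give $T^*S^6$ the Stenzel Calabi–Yau structure, i.e. the pull-back by $\Phi$ of the following structure on $Q$: the complex structure $I$ induced from $\mathbb C^7$; the Kähler form $\omega=\sqrt{-1}\sum_{i,j}\frac{\partial^2 u(r^2)}{\partial z_i\partial\bar z_j}dz_i\wedge d\bar z_j$ with $r^2=\|z\|^2$; the metric $g=\omega(\cdot,I\cdot)$; and the holomorphic volume form $\Omega_z(v_1,\dots,v_6)=\sqrt{2^6c}\,(dz_1\wedge\dots\wedge dz_7)(z,v_1,\dots,v_6)$. A special Lagrangian submanifold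 is an embedded $6$-dimensional submanifold $N$ with $\omega|_N=0$ for which there is a constant $\theta$ with $\Omega|_N=e^{\sqrt{-1}\theta}\,\mathrm{vol}_{g|_N}$, for a suitable orientation of $N$. Let $H=SO(2)\times SO(2)\times SO(3)$ be the group of block diagonal matrices in $SO(7)$ with blocks of sizes $2,2,3$, acting on $T^*S^6$ by $h\cdot(x,\xi)=(hx,h\xi)$. Let $\mu_{ij}(p)=u'(r^2)\,\mathrm{Re}\langle \sqrt{-1}\,z,\ \xi_{ij}z\rangle$, where $z=\Phi(p)$, $\xi_{ij}=E_{ji}-E_{ij}$ and $\langle a,b\rangle=\sum_k a_k\bar b_k$, be the components of the moment map. Let $$L=\{(x,\xi)\in T^*S^6 : x_2=x_4=x_6=x_7=0,\ \xi_1=\xi_3=\xi_5=0\}$$ (the conormal bundle of a totally geodesic $S^2$), let $\hat L=\{(x,\xi)\in L:\xi_6=\xi_7=0\}$, and let $\hat L^{\mathrm{pr}}$ be the set of $p\in\hat L$ whose isotropy subgroup satisfies $H_p\subset H_q$ for all $q\in\hat L$. For $(c_1,c_2)\in\mathbb R^2$ put $$\hat V_{(c_1,c_2)}=\hat L\cap\{\mu_{12}=c_1,\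 \mu_{34}=c_2,\ \mu_{56}=\mu_{57}=\mu_{67}=0\},\qquad V_{(c_1,c_2)}=\hat V_{(c_1,c_2)}\cap\hat L^{\mathrm{pr}}.$$ Then $H$ is non-abelian, and the following hold. 1. For every $(c_1,c_2)\neq(0,0)$ with $V_{(c_1,c_2)}\neq\emptyset$, the set $H\cdot V_{(c_1,c_2)}$ is a special Lagrangian submanifold of $T^*S^6$. 2. $H\cdot\hat V_{(0,0)}$ is the union of the five (not necessarily distinct or disjoint) sets $$H\cdot\{p\in\hat L:\xi=0\},\quad H\cdot\{p\in\hat L:x_1=0,\ \xi_4=0\},\quad H\cdot\{p\in\hat L:x_3=0,\ \xi_2=0\},\quad H\cdot\{p\in\hat L:x_1=x_3=0,\ x_5=\pm1\}.$$ Each of them is a connected special Lagrangian submanifold of $T^*S^6$. The first is diffeomorphic to $S^6$, the second and the third to the conormal bundle $T^{*\perp}S^4$ of a totally geodesic $S^4\subset S^6$, and the last two (one for each sign) to the conormal bundle $T^{*\perp}S^2$ of a totally geodesic $S^2\subset S^6$. -/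

import Mathlib

open scoped ContDiff Topology

noncomputable section

namespace Stenzel

/-! ### Submanifolds of finite-dimensional real vector spaces -/

/-- The tangent vectors at `p` to a subset `S` of a normed space: velocities at time `0` of smooth
curves through `p` that stay in `S`. -/
def tangentVectors {E : Type*} [NormedAddCommGroup E] [NormedSpace ℝ E] (S : Set E) (p : E) :
    Set E :=
  {v | ∃ γ : ℝ → E, ContDiffAt ℝ ∞ γ 0 ∧ γ 0 = p ∧ (∀ᶠ t in 𝓝 (0 : ℝ), γ t ∈ S) ∧
    HasDerivAt γ v 0}

/-- `S` is an embedded smooth submanifold of dimension `k` of the finite-dimensional space `E`: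
near each of its points it is the zero set of a smooth submersion to `ℝ^m`, `m = dim E - k`. -/
def IsSubmanifold {E : Type*} [NormedAddCommGroup E] [NormedSpace ℝ E] (k : ℕ) (S : Set E) :
    Prop :=
  ∀ p ∈ S, ∃ (m : ℕ) (O : Set E) (f : E → EuclideanSpace ℝ (Fin m)),
    m + k = Module.finrank ℝ E ∧ IsOpen O ∧ p ∈ O ∧ ContDiffOn ℝ ∞ f O ∧
    Function.Surjective (fderiv ℝ f p) ∧ S ∩ O = {q ∈ O | f q = 0}

/-- Two subsets (in practice: embedded submanifolds) of normed spaces are diffeomorphic. -/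
def AreDiffeomorphic {E F : Type*} [NormedAddCommGroup E] [NormedSpace ℝ E]
    [NormedAddCommGroup F] [NormedSpace ℝ F] (S : Set E) (T : Set F) : Prop :=
  ∃ (f : E → F) (g : F → E), ContDiffOn ℝ ∞ f S ∧ ContDiffOn ℝ ∞ g T ∧
    Set.MapsTo f S T ∧ Set.MapsTo g T S ∧ Set.InvOn g f S T

/-! ### The cotangent bundle of the sphere and the complex quadric -/

/-- `ℝ^(n+1)` with the Euclidean norm. -/
abbrev RSpace (n : ℕ) : Type := EuclideanSpace ℝ (Fin (n + 1))

/-- `ℂ^(n+1)` with the Hermitian norm. -/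
abbrev CSpace (n : ℕ) : Type := EuclideanSpace ℂ (Fin (n + 1))

/-- `T*S^n`, identified with the tangent bundle, as the set of pairs `(x, ξ)` with `‖x‖ = 1` and
`x ⬝ ξ = 0`. -/
def cotangentSphere (n : ℕ) : Set (RSpace n × RSpace n) :=
  {p | ‖p.1‖ = 1 ∧ inner ℝ p.1 p.2 = 0}

/-- The conormal bundle in `T*S^n` of a submanifold `N` of `S^n`. -/
def conormalBundle {n : ℕ} (N : Set (RSpace n)) : Set (RSpace n × RSpace n) :=
  {p | p ∈ cotangentSphere n ∧ p.1 ∈ N ∧ ∀ v ∈ tangentVectors N p.1, inner ℝ v p.2 = 0}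

/-- The totally geodesic `k`-sphere in `S^n` on which only the first `k + 1` coordinates are
nonzero. -/
def greatSphere (n k : ℕ) : Set (RSpace n) :=
  {x | ‖x‖ = 1 ∧ ∀ i : Fin (n + 1), k < (i : ℕ) → x i = 0}

/-- The map `Φ(x, ξ) = cosh ‖ξ‖ x + √-1 (sinh ‖ξ‖ / ‖ξ‖) ξ`. It restricts to a diffeomorphism from
`T*S^n` onto the quadric `∑ z_i ^ 2 = 1` in `ℂ^(n+1)`. (At `ξ = 0` the second term is `0`, which is
also its smooth extension.) -/
def toQuadric {n : ℕ} (p : RSpace n × RSpace n) : CSpace n :=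
  WithLp.toLp 2 fun i =>
    ((Real.cosh ‖p.2‖ * p.1 i : ℝ) : ℂ) +
      Complex.I * ((Real.sinh ‖p.2‖ / ‖p.2‖ * p.2 i : ℝ) : ℂ)

/-! ### The Stenzel Calabi-Yau structure -/

/-- `u` is a Stenzel potential: `u` is smooth on `[1, ∞)`, and `U(t) = u(cosh t)` satisfies
`d/dt (dU/dt)^n = c n (sinh t)^(n-1)` and `dU/dt > 0` for `t > 0`. -/
structure IsStenzelPotential (n : ℕ) (c : ℝ) (u : ℝ → ℝ) : Prop where
  smooth : ∀ s : ℝ, 1 ≤ s → ContDiffAt ℝ ∞ u s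
  ode : ∀ t : ℝ, 0 < t →
    HasDerivAt (fun s : ℝ => (deriv (fun r : ℝ => u (Real.cosh r)) s) ^ n)
      (c * n * Real.sinh t ^ (n - 1)) t
  deriv_pos : ∀ t : ℝ, 0 < t → 0 < deriv (fun r : ℝ => u (Real.cosh r)) t

/-- The Wirtinger derivative `∂f/∂z_j`. -/
def wirtinger {n : ℕ} (j : Fin (n + 1)) (f : CSpace n → ℂ) (z : CSpace n) : ℂ :=
  (fderiv ℝ f z (EuclideanSpace.single j 1) -
    Complex.I * fderiv ℝ f z (EuclideanSpace.single j Complex.I)) / 2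

/-- The Wirtinger derivative `∂f/∂(conj z_j)`. -/
def wirtingerBar {n : ℕ} (j : Fin (n + 1)) (f : CSpace n → ℂ) (z : CSpace n) : ℂ :=
  (fderiv ℝ f z (EuclideanSpace.single j 1) +
    Complex.I * fderiv ℝ f z (EuclideanSpace.single j Complex.I)) / 2

/-- The Kähler potential `u(r^2)`, `r^2 = ∑ z_i conj z_i`. -/
def potential {n : ℕ} (u : ℝ → ℝ) (z : CSpace n) : ℂ := ((u (‖z‖ ^ 2) : ℝ) : ℂ)

/-- The form `√-1 ∑ ∂²u(r^2)/∂z_i∂(conj z_j) dz_i ∧ d(conj z_j)` at `z`, on the pair `(v, w)`.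
Its restriction to the quadric is the Kähler form of the Stenzel metric (it is real valued). -/
def quadricForm {n : ℕ} (u : ℝ → ℝ) (z v w : CSpace n) : ℂ :=
  Complex.I * ∑ i : Fin (n + 1), ∑ j : Fin (n + 1),
    wirtinger i (wirtingerBar j (potential u)) z *
      (v i * (starRingEnd ℂ) (w j) - w i * (starRingEnd ℂ) (v j))

/-- The Kähler metric `g(v, w) = ω(v, I w)` on the quadric, `I` being multiplication by `√-1`. -/
def quadricMetric {n : ℕ} (u : ℝ → ℝ) (z v w : CSpace n) : ℝ :=
  (quadricForm u z v (Complex.I • w)).re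

/-- The holomorphic volume form `√(2^n c) (dz_1 ∧ … ∧ dz_(n+1))(z, v_1, …, v_n)` on the quadric.
Up to the constant it is the form `Ω₀` with `½ d(∑ z_i ^ 2) ∧ Ω₀ = dz_1 ∧ … ∧ dz_(n+1)`; the constant
is the one (unique up to a constant phase) for which the Calabi-Yau relation
`ω^n / n! = (-1)^(n(n-1)/2) (√-1 / 2)^n Ω ∧ conj Ω` holds for the Stenzel form with constant `c`. -/
def quadricVolume {n : ℕ} (c : ℝ) (z : CSpace n) (v : Fin n → CSpace n) : ℂ :=
  ((Real.sqrt (2 ^ n * c) : ℝ) : ℂ) *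
    Matrix.det (Matrix.of fun i j : Fin (n + 1) => (Fin.cons z v : Fin (n + 1) → CSpace n) i j)

/-- The Stenzel Kähler form on `T*S^n` (pull-back by `Φ`). -/
def stenzelForm {n : ℕ} (u : ℝ → ℝ) (p v w : RSpace n × RSpace n) : ℂ :=
  quadricForm u (toQuadric p) (fderiv ℝ toQuadric p v) (fderiv ℝ toQuadric p w)

/-- The Stenzel metric on `T*S^n` (pull-back by `Φ`). -/
def stenzelMetric {n : ℕ} (u : ℝ → ℝ) (p v w : RSpace n × RSpace n) : ℝ :=
  quadricMetric u (toQuadric p) (fderiv ℝ toQuadric p v) (fderiv ℝ toQuadric p w)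

/-- The holomorphic volume form on `T*S^n` (pull-back by `Φ`). -/
def stenzelVolume {n : ℕ} (c : ℝ) (p : RSpace n × RSpace n)
    (v : Fin n → RSpace n × RSpace n) : ℂ :=
  quadricVolume c (toQuadric p) fun i => fderiv ℝ toQuadric p (v i)

/-- `S` is a Lagrangian submanifold of `T*S^n` with the Stenzel structure. -/
def IsLagrangian {n : ℕ} (u : ℝ → ℝ) (S : Set (RSpace n × RSpace n)) : Prop :=
  S ⊆ cotangentSphere n ∧ IsSubmanifold n S ∧
    ∀ p ∈ S, ∀ v ∈ tangentVectors S p, ∀ w ∈ tangentVectors S p, stenzelForm u p v w = 0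

/-- `S` is a special Lagrangian submanifold: it is Lagrangian, and its Lagrangian angle is a
constant `θ`, that is, `Ω = ± e^(iθ)` on every orthonormal basis of every tangent space. (The sign is
that of the basis in the orientation of `S` for which `Ω` restricts to `e^(iθ)` times the Riemannian
volume form.) -/
def IsSpecialLagrangian {n : ℕ} (c : ℝ) (u : ℝ → ℝ) (S : Set (RSpace n × RSpace n)) : Prop :=
  IsLagrangian u S ∧
    ∃ θ : ℝ, ∀ p ∈ S, ∀ v : Fin n → RSpace n × RSpace n,
      (∀ i, v i ∈ tangentVectors S p) →
      (∀ i j, stenzelMetric u p (v i) (v j) = if i = j then 1 else 0) →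
      stenzelVolume c p v = Complex.exp (θ * Complex.I) ∨
        stenzelVolume c p v = -Complex.exp (θ * Complex.I)

/-- The matrix `ξ_ij = E_ji - E_ij` of `so(n+1)`, with indices starting at `0`. -/
def rotationGenerator {n : ℕ} (i j : Fin (n + 1)) : Matrix (Fin (n + 1)) (Fin (n + 1)) ℝ :=
  Matrix.single j i 1 - Matrix.single i j 1

/-- The moment map of the `SO(n+1)`-action: on the quadric `μ(z)(X) = u'(r^2) (I z ⬝ X z)` with the
real inner product of `ℂ^(n+1)`. Here it is evaluated at `z = Φ(p)`. -/
def momentMap {n : ℕ} (u : ℝ → ℝ) (p : RSpace n × RSpace n)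
    (X : Matrix (Fin (n + 1)) (Fin (n + 1)) ℝ) : ℝ :=
  deriv u (‖toQuadric p‖ ^ 2) *
    (∑ i : Fin (n + 1), (Complex.I * toQuadric p i) *
      (starRingEnd ℂ) (∑ j : Fin (n + 1), (X i j : ℂ) * toQuadric p j)).re

/-! ### The group `H = SO(2) × SO(2) × SO(3)` and the sets in `T*S^6` -/

/-- The block diagonal matrix with blocks `h₁, h₂, h₃`. -/
def blockMatrix (h₁ h₂ : Matrix (Fin 2) (Fin 2) ℝ) (h₃ : Matrix (Fin 3) (Fin 3) ℝ) :
    Matrix (Fin 7) (Fin 7) ℝ :=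
  !![h₁ 0 0, h₁ 0 1, 0, 0, 0, 0, 0;
     h₁ 1 0, h₁ 1 1, 0, 0, 0, 0, 0;
     0, 0, h₂ 0 0, h₂ 0 1, 0, 0, 0;
     0, 0, h₂ 1 0, h₂ 1 1, 0, 0, 0;
     0, 0, 0, 0, h₃ 0 0, h₃ 0 1, h₃ 0 2;
     0, 0, 0, 0, h₃ 1 0, h₃ 1 1, h₃ 1 2;
     0, 0, 0, 0, h₃ 2 0, h₃ 2 1, h₃ 2 2]

/-- The matrix group `H = SO(2) × SO(2) × SO(3)`, embedded block diagonally in `SO(7)`. -/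
def groupH : Set (Matrix (Fin 7) (Fin 7) ℝ) :=
  {A | ∃ h₁ ∈ Matrix.specialOrthogonalGroup (Fin 2) ℝ,
    ∃ h₂ ∈ Matrix.specialOrthogonalGroup (Fin 2) ℝ,
    ∃ h₃ ∈ Matrix.specialOrthogonalGroup (Fin 3) ℝ, A = blockMatrix h₁ h₂ h₃}

/-- The action `A · (x, ξ) = (A x, A ξ)`. -/
def act (A : Matrix (Fin 7) (Fin 7) ℝ) (p : RSpace 6 × RSpace 6) : RSpace 6 × RSpace 6 :=
  (WithLp.toLp 2 (A.mulVec p.1.ofLp), WithLp.toLp 2 (A.mulVec p.2.ofLp))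

/-- The isotropy subgroup `H_p`. -/
def isotropy (p : RSpace 6 × RSpace 6) : Set (Matrix (Fin 7) (Fin 7) ℝ) :=
  {A ∈ groupH | act A p = p}

/-- `H · S`. -/
def sweep (S : Set (RSpace 6 × RSpace 6)) : Set (RSpace 6 × RSpace 6) :=
  {q | ∃ A ∈ groupH, ∃ p ∈ S, q = act A p}

/-- `L`: the conormal bundle of the totally geodesic `S^2` of points `(x₁, 0, x₃, 0, x₅, 0, 0)`. -/
def conormalL : Set (RSpace 6 × RSpace 6) :=
  {p | ‖p.1‖ = 1 ∧ p.1 1 = 0 ∧ p.1 3 = 0 ∧ p.1 5 = 0 ∧ p.1 6 = 0 ∧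
    p.2 0 = 0 ∧ p.2 2 = 0 ∧ p.2 4 = 0}

/-- The rank two subbundle `L̂` of `L`, where `ξ₆ = ξ₇ = 0`. -/
def subbundleL : Set (RSpace 6 × RSpace 6) :=
  {p ∈ conormalL | p.2 5 = 0 ∧ p.2 6 = 0}

/-- The points of `L̂` whose isotropy subgroup lies in that of every point of `L̂`. -/
def principalL : Set (RSpace 6 × RSpace 6) :=
  {p ∈ subbundleL | ∀ q ∈ subbundleL, isotropy p ⊆ isotropy q}

/-- The common level set `μ₁₂ = c₁`, `μ₃₄ = c₂`, `μ₅₆ = μ₅₇ = μ₆₇ = 0` in `T*S^6`. -/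
def momentLevel (u : ℝ → ℝ) (c₁ c₂ : ℝ) : Set (RSpace 6 × RSpace 6) :=
  {p ∈ cotangentSphere 6 |
    momentMap u p (rotationGenerator 0 1) = c₁ ∧ momentMap u p (rotationGenerator 2 3) = c₂ ∧
    momentMap u p (rotationGenerator 4 5) = 0 ∧ momentMap u p (rotationGenerator 4 6) = 0 ∧
    momentMap u p (rotationGenerator 5 6) = 0}

/-- `V_(c₁,c₂)`. -/
def principalLevel (u : ℝ → ℝ) (c₁ c₂ : ℝ) : Set (RSpace 6 × RSpace 6) :=
  principalL ∩ momentLevel u c₁ c₂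

/-- `V̂_(c₁,c₂)`. -/
def fullLevel (u : ℝ → ℝ) (c₁ c₂ : ℝ) : Set (RSpace 6 × RSpace 6) :=
  subbundleL ∩ momentLevel u c₁ c₂

/-- The points `((x₁, 0, x₃, 0, x₅, 0, 0), 0)`; a 2-sphere. -/
def pieceSphere : Set (RSpace 6 × RSpace 6) := {p ∈ subbundleL | p.2 = 0}

/-- The points `((0, 0, x₃, 0, x₅, 0, 0), (0, ξ₂, 0, 0, 0, 0, 0))`; a copy of `S^1 × ℝ`. -/
def pieceCylinderOne : Set (RSpace 6 × RSpace 6) :=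
  {p ∈ subbundleL | p.1 0 = 0 ∧ p.2 3 = 0}

/-- The points `((x₁, 0, 0, 0, x₅, 0, 0), (0, 0, 0, ξ₄, 0, 0, 0))`; a copy of `S^1 × ℝ`. -/
def pieceCylinderThree : Set (RSpace 6 × RSpace 6) :=
  {p ∈ subbundleL | p.1 2 = 0 ∧ p.2 1 = 0}

/-- The points `((0, 0, 0, 0, ε, 0, 0), (0, ξ₂, 0, ξ₄, 0, 0, 0))`; for `ε = ± 1` a copy of `ℝ^2`. -/
def piecePlane (ε : ℝ) : Set (RSpace 6 × RSpace 6) :=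
  {p ∈ subbundleL | p.1 0 = 0 ∧ p.1 2 = 0 ∧ p.1 4 = ε}

end Stenzel

end

namespace Stenzel

/-! On the quadric, form and metric come from one Hermitian form `kahlerPairing`, K(v, w) = u'⟨v, w⟩
+ u''⟨v, z⟩⟨z, w⟩, with u', u'' taken at R = ‖z‖²: ω = -2 Im K and g = 2 Re K. The ODE for u is the
Monge-Ampère equation u'^(n-1) (R u' + (R² - 1) u'') = c (`IsStenzelPotential.monge_ampere`), and by
`normSq_det_of_orthonormal` it forces |Ω| = 1 on every tangent frame that is K-orthonormal up to the
factor 1/2. Hence a submanifold is special Lagrangian with phase 0 as soon as K(v, w) and det(z,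
v_1, …, v_n) are real on its tangent vectors (`isSpecialLagrangian_of_im_eq_zero`). All the sets in
question have phase 0, and reality is read off from linear equations satisfied by the tangent
vectors; the tangent spaces themselves are never computed.

Zero level: away from ξ = 0 the two nontrivial moment components are nonzero multiples of x₁ξ₂ and
x₃ξ₄, which gives the five pieces. Their H-sweeps are conormal bundles of coordinate spheres {x_i =
0, i ∈ I} with |I| = 0, 2 or 4 (the two planes have the same sweep, since SO(3) contains a map
taking the fifth basis vector to its negative). In z = Φ(x, ξ) such a bundle is "imaginary on I,
real off I", so K is real and the determinant is a real number times i^|I|, which is real because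
|I| is even.

Other levels: `sweep_principalLevel` describes H·V by eight equations on an open set: x ⊥ ξ in each
plane block, the two moment values, ‖x‖ = 1, and ξ = 0 in the last block. They form a submersion to
ℝ^8, so H·V has dimension 6. Their linearization on the quadric is `IsLevelTangent`. It makes K real
block by block (`block_kahler_eq_zero`). For the determinant, seven covectors are written down that
take real values on z and on all tangent vectors. Their determinant is the K-Gram determinant of the
two planar rotation fields, which is positive by the Monge-Ampère inequality (`gram_pos`); so the
determinant of the frame is real as well. -/

open ComplexConjugate in
/-- The Hermitian form `∑ ∂²u(r²)/∂z_i∂(conj z_j) v_i conj w_j`. -/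
noncomputable def kahlerPairing {n : ℕ} (u : ℝ → ℝ) (z v w : CSpace n) : ℂ :=
  (deriv u (‖z‖ ^ 2) : ℝ) * ∑ i, v i * conj (w i) +
    (deriv (deriv u) (‖z‖ ^ 2) : ℝ) * ((∑ i, v i * conj (z i)) * ∑ i, z i * conj (w i))

/-! ### The Kähler form and the metric as parts of one Hermitian form. -/

theorem normSq_eq_sum_re_im {n : ℕ} (z : CSpace n) :
    ‖z‖ ^ 2 = ∑ i, ((z i).re ^ 2 + (z i).im ^ 2) := by
  rw [EuclideanSpace.norm_sq_eq]
  refine Finset.sum_congr rfl fun i _ => ?_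
  rw [← Complex.normSq_eq_norm_sq, Complex.normSq_apply]
  ring

theorem ofReal_normSq_eq_sum {n : ℕ} (z : CSpace n) :
    ((‖z‖ ^ 2 : ℝ) : ℂ) = ∑ i, z i * (starRingEnd ℂ) (z i) := by
  rw [EuclideanSpace.norm_sq_eq]
  push_cast
  exact Finset.sum_congr rfl fun i _ => (Complex.mul_conj' _).symm

theorem hasFDerivAt_comp_normSq {n : ℕ} {f : ℝ → ℝ} {z : CSpace n}
    (hf : DifferentiableAt ℝ f (‖z‖ ^ 2)) :
    HasFDerivAt (fun y : CSpace n => ((f (‖y‖ ^ 2) : ℝ) : ℂ))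
      (Complex.ofRealCLM.comp (deriv f (‖z‖ ^ 2) • (2 • innerSL ℝ z))) z :=
  Complex.ofRealCLM.hasFDerivAt.comp z
    (hf.hasDerivAt.comp_hasFDerivAt z (hasStrictFDerivAt_norm_sq z).hasFDerivAt)

theorem inner_single_one {n : ℕ} (z : CSpace n) (j : Fin (n + 1)) :
    inner ℝ z (EuclideanSpace.single j (1 : ℂ)) = (z j).re := by
  rw [PiLp.inner_apply, Finset.sum_eq_single j]
  · simp
  · intro b _ hb
    simp [hb]
  · simp

theorem inner_single_I {n : ℕ} (z : CSpace n) (j : Fin (n + 1)) :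
    inner ℝ z (EuclideanSpace.single j Complex.I) = (z j).im := by
  rw [PiLp.inner_apply, Finset.sum_eq_single j]
  · simp
  · intro b _ hb
    simp [hb]
  · simp

theorem wirtingerBar_potential {n : ℕ} {u : ℝ → ℝ} {z : CSpace n}
    (hu : DifferentiableAt ℝ u (‖z‖ ^ 2)) (j : Fin (n + 1)) :
    wirtingerBar j (potential u) z = (deriv u (‖z‖ ^ 2) : ℝ) * z j := by
  have h : fderiv ℝ (potential u) z = _ := (hasFDerivAt_comp_normSq hu).fderiv
  rw [wirtingerBar, h]
  simp only [ContinuousLinearMap.comp_apply, smul_apply, innerSL_apply_apply,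
    inner_single_one, inner_single_I, Complex.ofRealCLM_apply]
  apply Complex.ext <;> simp <;> ring

theorem contDiffAt_deriv {f : ℝ → ℝ} {s : ℝ} (hf : ContDiffAt ℝ ∞ f s) :
    ContDiffAt ℝ ∞ (deriv f) s := by
  have h : ContDiffAt ℝ ∞ (fun r => fderiv ℝ f r 1) s :=
    (hf.fderiv_right (m := ∞) (by simp)).clm_apply contDiffAt_const
  exact h.congr_of_eventuallyEq (Filter.Eventually.of_forall fun r => by simp)

theorem wirtinger_wirtingerBar_potential {n : ℕ} {u : ℝ → ℝ} {z : CSpace n}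
    (hu : ContDiffAt ℝ ∞ u (‖z‖ ^ 2)) (i j : Fin (n + 1)) :
    wirtinger i (wirtingerBar j (potential u)) z =
      (deriv (deriv u) (‖z‖ ^ 2) : ℝ) * ((starRingEnd ℂ) (z i) * z j) +
        if i = j then ((deriv u (‖z‖ ^ 2) : ℝ) : ℂ) else 0 := by
  -- The outer derivative needs the formula for the inner one on a neighbourhood; smoothness at the
  -- single value ‖z‖² gives differentiability at nearby values.
  have hev : ∀ᶠ y : CSpace n in 𝓝 z, wirtingerBar j (potential u) y =
      (deriv u (‖y‖ ^ 2) : ℝ) * y j := by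
    have h1 : ∀ᶠ s in 𝓝 (‖z‖ ^ 2), DifferentiableAt ℝ u s := by
      filter_upwards [(hu.of_le (show (1 : WithTop ℕ∞) ≤ ∞ by norm_cast)).eventually (by simp)] with s hs
      exact hs.differentiableAt (by simp)
    have h2 : Filter.Tendsto (fun y : CSpace n => ‖y‖ ^ 2) (𝓝 z) (𝓝 (‖z‖ ^ 2)) :=
      (continuous_norm.pow 2).tendsto z
    filter_upwards [h2.eventually h1] with y hy
    exact wirtingerBar_potential hy j
  have hd : DifferentiableAt ℝ (deriv u) (‖z‖ ^ 2) := by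
    exact (contDiffAt_deriv hu).differentiableAt (by simp)
  have hj : HasFDerivAt (fun y : CSpace n => y j)
      ((EuclideanSpace.proj j : CSpace n →L[ℂ] ℂ).restrictScalars ℝ) z :=
    ((EuclideanSpace.proj j : CSpace n →L[ℂ] ℂ).restrictScalars ℝ).hasFDerivAt
  have h := ((hasFDerivAt_comp_normSq hd).mul hj).congr_of_eventuallyEq hev
  rw [wirtinger, h.fderiv]
  simp only [add_apply, smul_apply,
    ContinuousLinearMap.comp_apply, innerSL_apply_apply,
    inner_single_one, inner_single_I, Complex.ofRealCLM_apply]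
  rcases eq_or_ne i j with rfl | hij
  · apply Complex.ext <;> simp <;> ring
  · apply Complex.ext <;> simp [hij, hij.symm] <;> ring

theorem conj_kahlerPairing {n : ℕ} (u : ℝ → ℝ) (z v w : CSpace n) :
    (starRingEnd ℂ) (kahlerPairing u z v w) = kahlerPairing u z w v := by
  simp only [kahlerPairing, map_add, map_mul, map_sum, Complex.conj_conj, Complex.conj_ofReal]
  congr 1
  · simp only [mul_comm]
  · simp only [mul_comm]

theorem kahlerPairing_smul_I_right {n : ℕ} (u : ℝ → ℝ) (z v w : CSpace n) :
    kahlerPairing u z v (Complex.I • w) = -Complex.I * kahlerPairing u z v w := by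
  have h (y : CSpace n) : ∑ i, y i * (starRingEnd ℂ) ((Complex.I • w) i) =
      -Complex.I * ∑ i, y i * (starRingEnd ℂ) (w i) := by
    rw [Finset.mul_sum]
    refine Finset.sum_congr rfl fun i _ => ?_
    simp only [PiLp.smul_apply, smul_eq_mul, map_mul, Complex.conj_I]
    ring
  rw [kahlerPairing, kahlerPairing, h, h]
  ring

theorem sum_wirtinger_eq_kahlerPairing {n : ℕ} {u : ℝ → ℝ} {z : CSpace n}
    (hu : ContDiffAt ℝ ∞ u (‖z‖ ^ 2)) (v w : CSpace n) :
    ∑ i, ∑ j, wirtinger i (wirtingerBar j (potential u)) z * (v i * (starRingEnd ℂ) (w j)) =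
      kahlerPairing u z v w := by
  simp only [wirtinger_wirtingerBar_potential hu, kahlerPairing, add_mul, Finset.sum_add_distrib,
    ite_mul, zero_mul, Finset.sum_ite_eq, Finset.mem_univ, if_true]
  rw [add_comm, Finset.mul_sum, Finset.sum_mul_sum, Finset.mul_sum]
  congr 1
  refine Finset.sum_congr rfl fun i _ => ?_
  rw [Finset.mul_sum]
  exact Finset.sum_congr rfl fun j _ => by ring

theorem quadricForm_eq {n : ℕ} {u : ℝ → ℝ} {z : CSpace n}
    (hu : ContDiffAt ℝ ∞ u (‖z‖ ^ 2)) (v w : CSpace n) :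
    quadricForm u z v w = ((-2 * (kahlerPairing u z v w).im : ℝ) : ℂ) := by
  rw [quadricForm]
  simp only [mul_sub, Finset.sum_sub_distrib, sum_wirtinger_eq_kahlerPairing hu]
  rw [← conj_kahlerPairing u z v w]
  apply Complex.ext <;> simp
  ring

theorem quadricMetric_eq {n : ℕ} {u : ℝ → ℝ} {z : CSpace n}
    (hu : ContDiffAt ℝ ∞ u (‖z‖ ^ 2)) (v w : CSpace n) :
    quadricMetric u z v w = 2 * (kahlerPairing u z v w).re := by
  rw [quadricMetric, quadricForm_eq hu, kahlerPairing_smul_I_right]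
  simp

/-! ### Determinant identities and the volume of an orthonormal frame. -/

section Determinant

open Matrix

variable {R : Type*} [CommRing R] {n : ℕ}

theorem det_cons_add (a b : Fin (n + 1) → R) (N : Fin n → Fin (n + 1) → R) :
    det (of (Fin.cons (a + b) N : Fin (n + 1) → Fin (n + 1) → R)) =
      det (of (Fin.cons a N : Fin (n + 1) → Fin (n + 1) → R)) +
        det (of (Fin.cons b N : Fin (n + 1) → Fin (n + 1) → R)) := by
  simp only [det_succ_row_zero, ← Finset.sum_add_distrib]
  refine Finset.sum_congr rfl fun j _ => ?_
  simp only [of_apply, Fin.cons_zero, Pi.add_apply, mul_add, add_mul]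
  rfl

theorem det_cons_smul (r : R) (a : Fin (n + 1) → R) (N : Fin n → Fin (n + 1) → R) :
    det (of (Fin.cons (r • a) N : Fin (n + 1) → Fin (n + 1) → R)) =
      r * det (of (Fin.cons a N : Fin (n + 1) → Fin (n + 1) → R)) := by
  simp only [det_succ_row_zero, Finset.mul_sum]
  refine Finset.sum_congr rfl fun j _ => ?_
  simp only [of_apply, Fin.cons_zero, Pi.smul_apply, smul_eq_mul, mul_assoc, mul_left_comm r]
  rfl

theorem det_cons_add_smul_row (r : R) (c : Fin n → R) (a : Fin (n + 1) → R)
    (N : Fin n → Fin (n + 1) → R) :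
    det (of (Fin.cons a (fun i => r • N i + c i • a) : Fin (n + 1) → Fin (n + 1) → R)) =
      r ^ n * det (of (Fin.cons a N : Fin (n + 1) → Fin (n + 1) → R)) := by
  have h := det_mul_column (Fin.cons 1 (fun _ => r) : Fin (n + 1) → R)
    (of (Fin.cons a N : Fin (n + 1) → Fin (n + 1) → R))
  rw [Fin.prod_univ_succ] at h
  simp only [Fin.cons_zero, Fin.cons_succ, Finset.prod_const, Finset.card_univ, Fintype.card_fin,
    one_mul] at h
  rw [← h]
  refine det_eq_of_forall_row_eq_smul_add_const (Fin.cons 0 c) 0 rfl fun i j => ?_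
  refine Fin.cases ?_ (fun i => ?_) i <;> simp

/-- The matrix determinant lemma for a rank one update of a scalar matrix. -/
theorem det_smul_one_add_vecMulVec {F : Type*} [Field F] {r : F} (hr : r ≠ 0) (s : F)
    (a b : Fin (n + 1) → F) :
    det (r • (1 : Matrix (Fin (n + 1)) (Fin (n + 1)) F) + s • vecMulVec a b) =
      r ^ n * (r + s * (b ⬝ᵥ a)) := by
  have h : r • (1 : Matrix (Fin (n + 1)) (Fin (n + 1)) F) + s • vecMulVec a b =
      r • (1 + replicateCol Unit ((s / r) • a) * replicateRow Unit b) := by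
    rw [← vecMulVec_eq, smul_add, smul_vecMulVec, smul_smul, mul_div_cancel₀ _ hr]
  rw [h, det_smul, det_one_add_replicateCol_mul_replicateRow, Fintype.card_fin, dotProduct_smul,
    smul_eq_mul]
  field_simp
  ring

/-- On vectors orthogonal to `b`, replacing the first row by one with the same pairing with `b`. -/
theorem det_cons_congr {F : Type*} [Field F] {a a' b : Fin (n + 1) → F}
    {N : Fin n → Fin (n + 1) → F} (hb : b ≠ 0) (ha : a ⬝ᵥ b = a' ⬝ᵥ b)
    (hN : ∀ i, N i ⬝ᵥ b = 0) :
    det (of (Fin.cons a N : Fin (n + 1) → Fin (n + 1) → F)) =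
      det (of (Fin.cons a' N : Fin (n + 1) → Fin (n + 1) → F)) := by
  have h : det (of (Fin.cons (a + (-1 : F) • a') N : Fin (n + 1) → Fin (n + 1) → F)) = 0 := by
    refine exists_mulVec_eq_zero_iff.1 ⟨b, hb, ?_⟩
    funext i
    refine Fin.cases ?_ (fun i => ?_) i
    · simp only [mulVec, of_apply, Fin.cons_zero, neg_smul, one_smul, add_dotProduct,
        neg_dotProduct, ha, add_neg_cancel, Pi.zero_apply]
    · simpa [mulVec] using hN i
  rw [det_cons_add, det_cons_smul] at h
  linear_combination h

end Determinant

open Matrix in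
/-- The Monge-Ampère relation: a frame of the tangent space of the quadric at `z` that is orthonormal
for `2 ∑ ∂²u(r²)/∂z_i∂(conj z_j) dz_i d(conj z_j)` has a fixed complex volume. -/
theorem normSq_det_of_orthonormal {n : ℕ} {u : ℝ → ℝ} {z : CSpace n} {v : Fin n → CSpace n}
    (hz : ∑ i, z i * z i = 1) (hzv : ∀ k, ∑ i, z i * v k i = 0)
    (hu : deriv u (‖z‖ ^ 2) ≠ 0)
    (hK : ∀ i j, kahlerPairing u z (v i) (v j) = if i = j then 1 / 2 else 0) :
    deriv u (‖z‖ ^ 2) ^ n *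
      (‖z‖ ^ 2 * deriv u (‖z‖ ^ 2) + ((‖z‖ ^ 2) ^ 2 - 1) * deriv (deriv u) (‖z‖ ^ 2)) *
      Complex.normSq (det (of fun i j => (Fin.cons z v : Fin (n + 1) → CSpace n) i j)) =
    deriv u (‖z‖ ^ 2) * (1 / 2) ^ n := by
  set p := deriv u (‖z‖ ^ 2) with hp
  set q := deriv (deriv u) (‖z‖ ^ 2) with hq
  have hR := ofReal_normSq_eq_sum z
  set R := ‖z‖ ^ 2 with hRdef
  let a : Fin (n + 1) → ℂ := z
  let a' : Fin (n + 1) → ℂ := star a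
  let N : Fin n → Fin (n + 1) → ℂ := fun k => v k
  let N' : Fin n → Fin (n + 1) → ℂ := fun k => star (N k)
  let c : Fin n → ℂ := fun k => q * (a ⬝ᵥ N' k)
  let b : Fin n → Fin (n + 1) → ℂ := fun k => (p : ℂ) • N' k + c k • a'
  let M := of (Fin.cons a N : Fin (n + 1) → Fin (n + 1) → ℂ)
  let B := of (Fin.cons a b : Fin (n + 1) → Fin (n + 1) → ℂ)
  have haa : a ⬝ᵥ a = 1 := hz
  have haa' : a ⬝ᵥ a' = R := hR.symm
  have ha'a' : a' ⬝ᵥ a' = 1 := by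
    rw [show a' ⬝ᵥ a' = star (a ⬝ᵥ a) by rw [star_dotProduct_star], haa, star_one]
  have haN : ∀ k, a ⬝ᵥ N k = 0 := hzv
  have ha'N' : ∀ k, a' ⬝ᵥ N' k = 0 := fun k => by
    rw [show a' ⬝ᵥ N' k = star (N k ⬝ᵥ a) by rw [star_dotProduct_star, dotProduct_comm],
      dotProduct_comm, haN, star_zero]
  have ha' : a' ≠ 0 := by
    intro h
    simp [h] at ha'a'
  have hKb : ∀ i j, N i ⬝ᵥ b j = if i = j then 1 / 2 else 0 := fun i j => by
    rw [← hK, kahlerPairing, ← hRdef, ← hp, ← hq]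
    simp only [b, c, dotProduct_add, dotProduct_smul, smul_eq_mul]
    simp only [dotProduct, N, N', a, a', Pi.star_apply, RCLike.star_def]
    ring
  -- The rows `b k` represent the functionals K(·, v_k), so M Bᵀ is triangular: z·z = 1 in the
  -- corner, z·v_k = 0 below it, and the K-Gram matrix ½·1 in the remaining block.
  have hprod : M.det * B.det = (1 / 2) ^ n := by
    rw [← det_transpose B, ← det_mul, det_of_isUpperTriangular, Fin.prod_univ_succ]
    · have h0 : (M * Bᵀ) 0 0 = 1 := haa
      have hs : ∀ i : Fin n, (M * Bᵀ) i.succ i.succ = 1 / 2 := fun i => by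
        exact (hKb i i).trans (if_pos rfl)
      simp [h0, hs]
    · intro i j hij
      obtain ⟨i, rfl⟩ := Fin.exists_succ_eq.2 (Fin.ne_zero_of_lt hij)
      refine Fin.cases (fun _ => ?_) (fun j hij => ?_) j hij
      · have := haN i
        rwa [dotProduct_comm] at this
      · have := hKb i j
        rwa [if_neg (by rintro rfl; exact lt_irrefl _ hij)] at this
  have hconj : det (of (Fin.cons a' N' : Fin (n + 1) → Fin (n + 1) → ℂ)) = star M.det := by
    rw [← det_conjTranspose, ← det_transpose]
    congr 1
    ext i j
    refine Fin.cases ?_ (fun j => ?_) j <;> rfl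
  -- The conjugate vectors N' are orthogonal to a', so z may be exchanged for R·conj z, which has
  -- the same pairing with a'.
  have h1 : det (of (Fin.cons a N' : Fin (n + 1) → Fin (n + 1) → ℂ)) = R * star M.det := by
    rw [← hconj, ← det_cons_smul]
    refine det_cons_congr ha' ?_ fun k => by rw [dotProduct_comm, ha'N']
    rw [haa', smul_dotProduct, ha'a', smul_eq_mul, mul_one]
  have h2 : det (of (Fin.cons a' b : Fin (n + 1) → Fin (n + 1) → ℂ)) = p ^ n * star M.det := by
    rw [← hconj]
    exact det_cons_add_smul_row _ _ _ _
  -- Right multiplication by p·1 + q·(a ⊗ a') turns each row N'_k into b_k and the row a into p·a +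
  -- q·a', since a·a = 1. Splitting the first row expresses det B through the conjugate of det M.
  have h3 : det (of (Fin.cons a N' : Fin (n + 1) → Fin (n + 1) → ℂ)) *
      det ((p : ℂ) • (1 : Matrix (Fin (n + 1)) (Fin (n + 1)) ℂ) + (q : ℂ) • vecMulVec a a') =
      p * B.det + q * det (of (Fin.cons a' b : Fin (n + 1) → Fin (n + 1) → ℂ)) := by
    rw [← det_mul, ← det_cons_smul, ← det_cons_smul, ← det_cons_add]
    congr 1
    rw [Matrix.mul_add, Matrix.mul_smul, Matrix.mul_smul, Matrix.mul_one, mul_vecMulVec]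
    ext i j
    refine Fin.cases ?_ (fun i => ?_) i
    · simp [vecMulVec_apply, mulVec, haa]
    · simp [vecMulVec_apply, mulVec, b, c, dotProduct_comm]
      ring
  rw [det_smul_one_add_vecMulVec (by exact_mod_cast hu), h1, h2, dotProduct_comm, haa'] at h3
  have h4 : ((p ^ n * (R * p + (R ^ 2 - 1) * q) * Complex.normSq M.det : ℝ) : ℂ) =
      ((p * (1 / 2) ^ n : ℝ) : ℂ) := by
    push_cast
    rw [← hprod, ← Complex.mul_conj]
    simp only [RCLike.star_def] at h3
    linear_combination M.det * h3
  have hM : M = of fun i j => (Fin.cons z v : Fin (n + 1) → CSpace n) i j := by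
    ext i j
    refine Fin.cases ?_ (fun i => ?_) i <;> rfl
  rw [← hM]
  exact_mod_cast h4

/-! ### The ODE of the potential as a Monge-Ampère equation. -/

section Potential

variable {n : ℕ} {c : ℝ} {u : ℝ → ℝ}

theorem IsStenzelPotential.deriv_comp_cosh (hu : IsStenzelPotential n c u) (t : ℝ) :
    deriv (fun r => u (Real.cosh r)) t = deriv u (Real.cosh t) * Real.sinh t :=
  (((hu.smooth _ (Real.one_le_cosh t)).differentiableAt (by simp)).hasDerivAt.comp t
    (Real.hasDerivAt_cosh t)).deriv

/-- Here U' = u'(cosh t) sinh t; expand the derivative of its n-th power and cancel n (sinh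
t)^(n-1). -/
theorem IsStenzelPotential.monge_ampere_of_pos (hu : IsStenzelPotential n c u) (hn : n ≠ 0)
    {t : ℝ} (ht : 0 < t) :
    0 < deriv u (Real.cosh t) ∧ deriv u (Real.cosh t) ^ (n - 1) *
      (Real.cosh t * deriv u (Real.cosh t) +
        (Real.cosh t ^ 2 - 1) * deriv (deriv u) (Real.cosh t)) = c := by
  have hs := Real.sinh_pos_iff.2 ht
  refine ⟨pos_of_mul_pos_left ((hu.deriv_comp_cosh t).symm ▸ hu.deriv_pos t ht) hs.le, ?_⟩
  have h := hu.ode t ht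
  simp only [hu.deriv_comp_cosh] at h
  have hd := (contDiffAt_deriv (hu.smooth _ (Real.one_le_cosh t))).differentiableAt (by simp)
  have h' := ((hd.hasDerivAt.comp t (Real.hasDerivAt_cosh t)).mul (Real.hasDerivAt_sinh t)).pow n
  have he := h.unique h'
  simp only [Function.comp_apply, Pi.mul_apply, mul_pow] at he
  have hn' : (n : ℝ) * Real.sinh t ^ (n - 1) ≠ 0 :=
    mul_ne_zero (Nat.cast_ne_zero.2 hn) (pow_ne_zero _ hs.ne')
  apply mul_left_cancel₀ hn'
  rw [← Real.sinh_sq]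
  linear_combination -he

/-- The ODE is given only for t > 0, while the zero section needs t = 0. Both statements pass to the
limit, except that u' could become 0 there; then the equation would read 0 = c. -/
theorem IsStenzelPotential.monge_ampere (hu : IsStenzelPotential n c u) (hc : 0 < c) (hn : n ≠ 0)
    {t : ℝ} (ht : 0 ≤ t) :
    0 < deriv u (Real.cosh t) ∧ deriv u (Real.cosh t) ^ (n - 1) *
      (Real.cosh t * deriv u (Real.cosh t) +
        (Real.cosh t ^ 2 - 1) * deriv (deriv u) (Real.cosh t)) = c := by
  rcases ht.eq_or_lt with rfl | ht
  · have hsm := contDiffAt_deriv (hu.smooth _ (Real.one_le_cosh 0))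
    have hc1 : ContinuousAt (fun t => deriv u (Real.cosh t)) 0 :=
      hsm.continuousAt.comp (f := Real.cosh) Real.continuous_cosh.continuousAt
    have hc2 : ContinuousAt (fun t => deriv (deriv u) (Real.cosh t)) 0 :=
      (contDiffAt_deriv hsm).continuousAt.comp (f := Real.cosh) Real.continuous_cosh.continuousAt
    have hc3 : ContinuousAt (fun t => deriv u (Real.cosh t) ^ (n - 1) *
        (Real.cosh t * deriv u (Real.cosh t) +
          (Real.cosh t ^ 2 - 1) * deriv (deriv u) (Real.cosh t))) 0 :=
      (hc1.pow _).mul ((Real.continuous_cosh.continuousAt.mul hc1).add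
        (((Real.continuous_cosh.continuousAt.pow 2).sub continuousAt_const).mul hc2))
    have hpos : ∀ᶠ t : ℝ in 𝓝[>] 0, 0 < t := self_mem_nhdsWithin
    have heq := tendsto_nhds_unique
      (hc3.tendsto.mono_left nhdsWithin_le_nhds : Filter.Tendsto _ (𝓝[>] (0 : ℝ)) _)
      (tendsto_const_nhds.congr' (by
        filter_upwards [hpos] with t ht
        exact (hu.monge_ampere_of_pos hn ht).2.symm))
    refine ⟨lt_of_le_of_ne (ge_of_tendsto
      (hc1.tendsto.mono_left nhdsWithin_le_nhds : Filter.Tendsto _ (𝓝[>] (0 : ℝ)) _) (by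
        filter_upwards [hpos] with t ht
        exact (hu.monge_ampere_of_pos hn ht).1.le)) fun h0 => ?_, heq⟩
    rw [← h0] at heq
    rw [Real.cosh_zero] at heq
    linarith
  · exact hu.monge_ampere_of_pos hn ht

end Potential

/-! ### The map Φ, its differential, and the criterion for phase 0. -/

section Quadric

variable {n : ℕ}

theorem re_toQuadric (p : RSpace n × RSpace n) (i : Fin (n + 1)) :
    (toQuadric p i).re = Real.cosh ‖p.2‖ * p.1 i := by
  simp only [toQuadric, Complex.add_re, Complex.ofReal_re, Complex.mul_re, Complex.I_re,
    Complex.I_im, Complex.ofReal_im]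
  ring

theorem im_toQuadric (p : RSpace n × RSpace n) (i : Fin (n + 1)) :
    (toQuadric p i).im = Real.sinh ‖p.2‖ / ‖p.2‖ * p.2 i := by
  simp only [toQuadric, Complex.add_im, Complex.ofReal_re, Complex.mul_im, Complex.I_re,
    Complex.I_im, Complex.ofReal_im]
  ring

theorem inner_eq_sum (x y : RSpace n) : inner ℝ x y = ∑ i, x i * y i := by
  rw [PiLp.inner_apply]
  exact Finset.sum_congr rfl fun i _ => by simp [mul_comm]

theorem sinh_div_mul_self (r : ℝ) : Real.sinh r / r * r = Real.sinh r := by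
  rcases eq_or_ne r 0 with rfl | hr
  · simp
  · exact div_mul_cancel₀ _ hr

theorem normSq_toQuadric {p : RSpace n × RSpace n} (hp : ‖p.1‖ = 1) :
    ‖toQuadric p‖ ^ 2 = Real.cosh (2 * ‖p.2‖) := by
  rw [normSq_eq_sum_re_im]
  simp only [re_toQuadric, im_toQuadric, mul_pow, Finset.sum_add_distrib, ← Finset.mul_sum]
  rw [← EuclideanSpace.real_norm_sq_eq, ← EuclideanSpace.real_norm_sq_eq, ← mul_pow _ ‖p.2‖,
    sinh_div_mul_self, hp, Real.cosh_two_mul]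
  ring

theorem sum_toQuadric_mul_self {p : RSpace n × RSpace n} (hp : p ∈ cotangentSphere n) :
    ∑ i, toQuadric p i * toQuadric p i = 1 := by
  have h1 : ∑ i, p.1 i ^ 2 = 1 := by rw [← EuclideanSpace.real_norm_sq_eq, hp.1, one_pow]
  have h2 : ∑ i, p.1 i * p.2 i = 0 := by rw [← inner_eq_sum, hp.2]
  apply Complex.ext
  · simp only [Complex.re_sum, Complex.mul_re, re_toQuadric, im_toQuadric, Complex.one_re,
      Finset.sum_sub_distrib]
    rw [← Real.cosh_sq_sub_sinh_sq ‖p.2‖, ← sinh_div_mul_self ‖p.2‖, mul_pow _ ‖p.2‖,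
      EuclideanSpace.real_norm_sq_eq, sinh_div_mul_self]
    conv_rhs => rw [← mul_one (Real.cosh ‖p.2‖ ^ 2), ← h1]
    simp only [Finset.mul_sum]
    congr 1 <;> exact Finset.sum_congr rfl fun i _ => by ring
  · simp only [Complex.im_sum, Complex.mul_im, re_toQuadric, im_toQuadric, Complex.one_im]
    rw [← mul_zero (2 * Real.cosh ‖p.2‖ * (Real.sinh ‖p.2‖ / ‖p.2‖)), ← h2, Finset.mul_sum]
    exact Finset.sum_congr rfl fun i _ => by ring

/-- The norm is not differentiable at 0, but a radial function vanishing to first order is. This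
handles the zero section in the differentiability of Φ. -/
theorem isLittleO_comp_norm {E : Type*} [NormedAddCommGroup E] {φ : ℝ → ℝ} (h0 : φ 0 = 0)
    (h : HasDerivAt φ 0 0) : (fun η : E => φ ‖η‖) =o[𝓝 0] fun η : E => η := by
  have h1 : (fun r : ℝ => φ r) =o[𝓝 0] fun r : ℝ => r := by
    simpa [h0] using hasDerivAt_iff_isLittleO_nhds_zero.1 h
  have h2 : Filter.Tendsto (fun η : E => ‖η‖) (𝓝 0) (𝓝 0) := by
    simpa using (continuous_norm (E := E)).tendsto 0
  exact (h1.comp_tendsto h2).of_norm_right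

theorem differentiableAt_cosh_norm (ξ : RSpace n) :
    DifferentiableAt ℝ (fun η : RSpace n => Real.cosh ‖η‖) ξ := by
  rcases eq_or_ne ξ 0 with rfl | hξ
  · have h : HasDerivAt (fun r => Real.cosh r - 1) 0 0 := by
      simpa using (Real.hasDerivAt_cosh 0).sub_const 1
    refine (HasFDerivAt.of_isLittleO (f' := (0 : RSpace n →L[ℝ] ℝ)) ?_).differentiableAt
    simpa using isLittleO_comp_norm (E := RSpace n) (by simp) h
  · exact (Real.differentiable_cosh _).comp ξ
      ((contDiffAt_norm ℝ hξ (n := 1)).differentiableAt one_ne_zero)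

theorem differentiableAt_sinh_div_norm_mul (ξ : RSpace n) (i : Fin (n + 1)) :
    DifferentiableAt ℝ (fun η : RSpace n => Real.sinh ‖η‖ / ‖η‖ * η i) ξ := by
  rcases eq_or_ne ξ 0 with rfl | hξ
  · have h : HasDerivAt (fun r => Real.sinh r - r) 0 0 := by
      simpa using (Real.hasDerivAt_sinh 0).fun_sub (hasDerivAt_id' 0)
    refine (HasFDerivAt.of_isLittleO
      (f' := (EuclideanSpace.proj i : RSpace n →L[ℝ] ℝ)) ?_).differentiableAt
    -- Since |η_i| ≤ ‖η‖, the deviation from the linear map η ↦ η_i is at most |sinh ‖η‖ - ‖η‖|.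
    refine (Asymptotics.IsBigO.of_norm_le (g := fun η : RSpace n => ‖Real.sinh ‖η‖ - ‖η‖‖)
      fun η => ?_).trans_isLittleO
      (by simpa using (isLittleO_comp_norm (E := RSpace n) (by simp) h).norm_left)
    have h1 : |η i| ≤ ‖η‖ := PiLp.norm_apply_le η i
    rcases eq_or_ne η 0 with rfl | hη
    · simp
    · have hpos : 0 < ‖η‖ := norm_pos_iff.2 hη
      have h2 : Real.sinh ‖η‖ / ‖η‖ * η i - η i = (Real.sinh ‖η‖ - ‖η‖) * (η i / ‖η‖) := by
        field_simp
      have h3 : |η i / ‖η‖| ≤ 1 := by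
        rw [abs_div, abs_of_pos hpos]
        exact (div_le_one hpos).2 h1
      simp only [PiLp.zero_apply, mul_zero, sub_zero, EuclideanSpace.coe_proj, Real.norm_eq_abs]
      rw [h2, abs_mul]
      exact mul_le_of_le_one_right (abs_nonneg _) h3
  · have h1 : DifferentiableAt ℝ (fun η : RSpace n => ‖η‖) ξ :=
      (contDiffAt_norm ℝ hξ (n := 1)).differentiableAt one_ne_zero
    have h2 : DifferentiableAt ℝ (fun r : ℝ => Real.sinh r / r) ‖ξ‖ :=
      (Real.differentiable_sinh _).fun_div differentiableAt_id (norm_ne_zero_iff.2 hξ)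
    exact (h2.comp ξ h1).fun_mul (by fun_prop)

theorem differentiableAt_toQuadric (p : RSpace n × RSpace n) :
    DifferentiableAt ℝ (toQuadric (n := n)) p := by
  refine (differentiableAt_piLp 2).2 fun i => ?_
  have h1 : DifferentiableAt ℝ (fun q : RSpace n × RSpace n => Real.cosh ‖q.2‖ * q.1 i) p :=
    ((differentiableAt_cosh_norm p.2).comp p differentiableAt_snd).mul (by fun_prop)
  have h2 : DifferentiableAt ℝ
      (fun q : RSpace n × RSpace n => Real.sinh ‖q.2‖ / ‖q.2‖ * q.2 i) p :=
    (differentiableAt_sinh_div_norm_mul p.2 i).comp p differentiableAt_snd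
  exact (Complex.ofRealCLM.differentiableAt.comp p h1).add
    ((differentiableAt_const _).mul (Complex.ofRealCLM.differentiableAt.comp p h2))

/-- Differentiate F ∘ Φ along a curve in S. Every linear equation used for tangent vectors below is
an instance for a suitable F. -/
theorem fderiv_toQuadric_mem_ker {G : Type*} [NormedAddCommGroup G] [NormedSpace ℝ G]
    {S : Set (RSpace n × RSpace n)} {p v : RSpace n × RSpace n} (hv : v ∈ tangentVectors S p)
    {F : CSpace n → G} {F' : CSpace n →L[ℝ] G} (hF : HasFDerivAt F F' (toQuadric p)) {a : G}
    (ha : ∀ q ∈ S, F (toQuadric q) = a) : F' (fderiv ℝ toQuadric p v) = 0 := by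
  obtain ⟨γ, -, h0, hS, hγ⟩ := hv
  subst h0
  have h := hF.comp_hasDerivAt (0 : ℝ)
    ((differentiableAt_toQuadric (γ 0)).hasFDerivAt.comp_hasDerivAt (0 : ℝ) hγ)
  exact h.unique ((hasDerivAt_const (0 : ℝ) a).congr_of_eventuallyEq
    (hS.mono fun t ht => ha _ ht))

theorem apply_fderiv_toQuadric {S : Set (RSpace n × RSpace n)} {p v : RSpace n × RSpace n}
    (hv : v ∈ tangentVectors S p) (ℓ : CSpace n →L[ℝ] ℝ) (ha : ∀ q ∈ S, ℓ (toQuadric q) = 0) :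
    ℓ (fderiv ℝ toQuadric p v) = 0 :=
  fderiv_toQuadric_mem_ker hv ℓ.hasFDerivAt ha

theorem hasFDerivAt_coord (z : CSpace n) (i : Fin (n + 1)) :
    HasFDerivAt (fun y : CSpace n => y i)
      ((EuclideanSpace.proj i : CSpace n →L[ℂ] ℂ).restrictScalars ℝ) z :=
  ((EuclideanSpace.proj i : CSpace n →L[ℂ] ℂ).restrictScalars ℝ).hasFDerivAt

theorem sum_toQuadric_mul_fderiv {S : Set (RSpace n × RSpace n)} (hS : S ⊆ cotangentSphere n)
    {p v : RSpace n × RSpace n} (hv : v ∈ tangentVectors S p) :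
    ∑ i, toQuadric p i * fderiv ℝ toQuadric p v i = 0 := by
  have hF : HasFDerivAt (fun y : CSpace n => ∑ i, y i * y i) _ (toQuadric p) :=
    HasFDerivAt.fun_sum fun i _ => (hasFDerivAt_coord _ i).mul (hasFDerivAt_coord _ i)
  have h := fderiv_toQuadric_mem_ker hv hF fun q hq => sum_toQuadric_mul_self (hS hq)
  simp only [sum_apply, add_apply, smul_apply, smul_eq_mul,
    ContinuousLinearMap.coe_restrictScalars', EuclideanSpace.coe_proj,
    ← two_mul, ← Finset.mul_sum] at h
  simpa using h

theorem two_pow_mul_eq_one {n : ℕ} (hn : n ≠ 0) {a d x c : ℝ} (ha : a ≠ 0)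
    (hc : a ^ (n - 1) * d = c) (h : a ^ n * d * x = a * (1 / 2) ^ n) : 2 ^ n * c * x = 1 := by
  have h2 : (2 : ℝ) ^ n * (1 / 2) ^ n = 1 := by
    rw [← mul_pow]
    norm_num
  rw [← mul_pow_sub_one hn a] at h
  have h3 : c * x = (1 / 2) ^ n := by
    apply mul_left_cancel₀ ha
    rw [← h, ← hc]
    ring
  rw [mul_assoc, h3, h2]

open Matrix in
-- On a g-orthonormal frame, K has real part δ/2 and, by hypothesis, imaginary part 0, so the
-- Monge-Ampère relation gives |Ω| = 1; a real number of modulus 1 is ±1, and the phase is 0.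
theorem isSpecialLagrangian_of_im_eq_zero {c : ℝ} {u : ℝ → ℝ} (hu : IsStenzelPotential n c u)
    (hc : 0 < c) (hn : n ≠ 0) {S : Set (RSpace n × RSpace n)} (hS : S ⊆ cotangentSphere n)
    (hsub : IsSubmanifold n S)
    (hω : ∀ p ∈ S, ∀ v ∈ tangentVectors S p, ∀ w ∈ tangentVectors S p,
      (kahlerPairing u (toQuadric p) (fderiv ℝ toQuadric p v) (fderiv ℝ toQuadric p w)).im = 0)
    (hΩ : ∀ p ∈ S, ∀ v : Fin n → RSpace n × RSpace n, (∀ i, v i ∈ tangentVectors S p) →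
      (det (of fun i j => (Fin.cons (toQuadric p) (fun i => fderiv ℝ toQuadric p (v i)) :
        Fin (n + 1) → CSpace n) i j)).im = 0) :
    IsSpecialLagrangian c u S := by
  have hsm : ∀ p ∈ S, ContDiffAt ℝ ∞ u (‖toQuadric p‖ ^ 2) := fun p hp => by
    rw [normSq_toQuadric (hS hp).1]
    exact hu.smooth _ (Real.one_le_cosh _)
  refine ⟨⟨hS, hsub, fun p hp v hv w hw => ?_⟩, 0, fun p hp v hv hg => ?_⟩
  · rw [stenzelForm, quadricForm_eq (hsm p hp), hω p hp v hv w hw]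
    simp
  · have hK : ∀ i j, kahlerPairing u (toQuadric p) (fderiv ℝ toQuadric p (v i))
        (fderiv ℝ toQuadric p (v j)) = if i = j then 1 / 2 else 0 := fun i j => by
      have h := hg i j
      rw [stenzelMetric, quadricMetric_eq (hsm p hp)] at h
      apply Complex.ext
      · split_ifs at h ⊢ <;> norm_num <;> linarith
      · rw [hω p hp _ (hv i) _ (hv j)]
        split_ifs <;> simp
    -- The parameter is 2‖ξ‖ because ‖Φ(x, ξ)‖² = cosh(2‖ξ‖).
    have hma := hu.monge_ampere hc hn (t := 2 * ‖p.2‖) (by positivity)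
    rw [← normSq_toQuadric (hS hp).1] at hma
    have hdet := normSq_det_of_orthonormal (sum_toQuadric_mul_self (hS hp))
      (fun k => sum_toQuadric_mul_fderiv hS (hv k)) hma.1.ne' hK
    have him := hΩ p hp v hv
    rw [stenzelVolume, quadricVolume]
    set d := det (of fun i j => (Fin.cons (toQuadric p) (fun i => fderiv ℝ toQuadric p (v i)) :
        Fin (n + 1) → CSpace n) i j)
    have hsq : (Real.sqrt (2 ^ n * c) * d.re) ^ 2 = 1 := by
      rw [mul_pow, Real.sq_sqrt (by positivity)]
      rw [Complex.normSq_apply, him, mul_zero, add_zero, ← sq] at hdet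
      exact two_pow_mul_eq_one hn hma.1.ne' hma.2 hdet
    have hd : d = (d.re : ℂ) := Complex.ext rfl (by simpa using him)
    rw [hd, ← Complex.ofReal_mul]
    simp only [Complex.ofReal_zero, zero_mul, Complex.exp_zero]
    rcases eq_or_eq_neg_of_sq_eq_sq _ 1 (hsq.trans (one_pow 2).symm) with h | h
    · exact Or.inl (by rw [h, Complex.ofReal_one])
    · exact Or.inr (by rw [h, Complex.ofReal_neg, Complex.ofReal_one])

end Quadric

theorem isSubmanifold_of_surjective_fderiv {E F : Type*} [NormedAddCommGroup E] [NormedSpace ℝ E]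
    [NormedAddCommGroup F] [NormedSpace ℝ F] [FiniteDimensional ℝ F] {k : ℕ} {S : Set E}
    (hk : Module.finrank ℝ F + k = Module.finrank ℝ E)
    (h : ∀ p ∈ S, ∃ (O : Set E) (f : E → F), IsOpen O ∧ p ∈ O ∧ ContDiffOn ℝ ∞ f O ∧
      Function.Surjective (fderiv ℝ f p) ∧ S ∩ O = {q ∈ O | f q = 0}) :
    IsSubmanifold k S := by
  intro p hp
  obtain ⟨O, f, hO, hpO, hf, hs, hS⟩ := h p hp
  let e : F ≃L[ℝ] EuclideanSpace ℝ (Fin (Module.finrank ℝ F)) :=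
    ContinuousLinearEquiv.ofFinrankEq (by simp)
  refine ⟨_, O, e ∘ f, hk, hO, hpO, e.contDiff.comp_contDiffOn hf, ?_, ?_⟩
  · rw [e.comp_fderiv]
    exact e.surjective.comp hs
  · simp [hS]

/-! ### Conormal bundles of coordinate spheres. -/

section CoordinateConormal

variable {n : ℕ}

/-- The conormal bundle of the totally geodesic sphere `{x ∈ S^n : x_i = 0 for i ∈ I}`. -/
def coordinateConormal (I : Finset (Fin (n + 1))) : Set (RSpace n × RSpace n) :=
  {p | ‖p.1‖ = 1 ∧ (∀ i ∈ I, p.1 i = 0) ∧ ∀ i ∉ I, p.2 i = 0}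

theorem coordinateConormal_subset (I : Finset (Fin (n + 1))) :
    coordinateConormal I ⊆ cotangentSphere n := by
  rintro p ⟨h1, h2, h3⟩
  refine ⟨h1, ?_⟩
  rw [inner_eq_sum]
  refine Finset.sum_eq_zero fun i _ => ?_
  by_cases hi : i ∈ I
  · rw [h2 i hi, zero_mul]
  · rw [h3 i hi, mul_zero]

theorem isSubmanifold_coordinateConormal (I : Finset (Fin (n + 1))) :
    IsSubmanifold n (coordinateConormal I) := by
  refine isSubmanifold_of_surjective_fderiv (F := ℝ × (Fin (n + 1) → ℝ)) ?_ fun p hp => ?_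
  · simp
    ring
  let f : RSpace n × RSpace n → ℝ × (Fin (n + 1) → ℝ) := fun q =>
    (‖q.1‖ ^ 2 - 1, fun i => if i ∈ I then q.1 i else q.2 i)
  have hf : ContDiff ℝ ∞ f := by
    refine ContDiff.prodMk ((contDiff_fst.norm_sq ℝ).sub contDiff_const) (contDiff_pi.2 fun i => ?_)
    by_cases hi : i ∈ I
    · simp only [hi, if_true]
      fun_prop
    · simp only [hi, if_false]
      fun_prop
  refine ⟨Set.univ, f, isOpen_univ, trivial, hf.contDiffOn, ?_, ?_⟩
  · let e (i : Fin (n + 1)) : RSpace n →L[ℝ] ℝ := EuclideanSpace.proj i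
    have h1 : HasFDerivAt (fun q : RSpace n × RSpace n => ‖q.1‖ ^ 2 - 1)
        ((2 • innerSL ℝ p.1).comp (ContinuousLinearMap.fst ℝ (RSpace n) (RSpace n))) p :=
      ((hasStrictFDerivAt_norm_sq p.1).hasFDerivAt.comp p hasFDerivAt_fst).sub_const 1
    have h2 : HasFDerivAt (fun (q : RSpace n × RSpace n) i => if i ∈ I then q.1 i else q.2 i)
        (ContinuousLinearMap.pi fun i =>
          if i ∈ I then (e i).comp (ContinuousLinearMap.fst ℝ _ _)
          else (e i).comp (ContinuousLinearMap.snd ℝ _ _)) p := by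
      refine hasFDerivAt_pi.2 fun i => ?_
      by_cases hi : i ∈ I
      · simp only [hi, if_true]
        exact ((e i).comp (ContinuousLinearMap.fst ℝ (RSpace n) (RSpace n))).hasFDerivAt
      · simp only [hi, if_false]
        exact ((e i).comp (ContinuousLinearMap.snd ℝ (RSpace n) (RSpace n))).hasFDerivAt
    rw [show fderiv ℝ f p = _ from (h1.prodMk h2).fderiv]
    rintro ⟨t, y⟩
    -- Off I, moving x along itself adjusts ‖x‖²; on I, x vanishes, so prescribing those coordinates
    -- leaves ‖x‖² unchanged to first order.
    let a : RSpace n := WithLp.toLp 2 fun i => if i ∈ I then y i else t / 2 * p.1 i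
    let b : RSpace n := WithLp.toLp 2 y
    refine ⟨(a, b), Prod.ext ?_ (funext fun i => ?_)⟩
    · have h3 : inner ℝ p.1 a = t / 2 := by
        have h4 : ∑ i, p.1 i ^ 2 = 1 := by rw [← EuclideanSpace.real_norm_sq_eq, hp.1, one_pow]
        rw [inner_eq_sum, ← mul_one (t / 2), ← h4, Finset.mul_sum]
        refine Finset.sum_congr rfl fun i _ => ?_
        by_cases hi : i ∈ I
        · simp [hp.2.1 i hi]
        · simp only [a, hi, if_false]
          ring
      simp [h3]
      ring
    · by_cases hi : i ∈ I
      · simp [hi, e, a]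
      · simp [hi, e, b]
  · rw [Set.inter_univ]
    ext q
    simp only [coordinateConormal, Set.mem_ofPred_eq, Set.mem_univ, true_and, f, Prod.mk_eq_zero,
      sub_eq_zero, funext_iff, Pi.zero_apply]
    refine and_congr ?_ ⟨fun h i => ?_, fun h => ⟨fun i hi => ?_, fun i hi => ?_⟩⟩
    · exact ⟨fun h => by rw [h, one_pow],
        fun h => (pow_eq_one_iff_of_nonneg (norm_nonneg _) two_ne_zero).1 h⟩
    · by_cases hi : i ∈ I
      · simp only [hi, if_true, h.1 i hi]
      · simp only [hi, if_false, h.2 i hi]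
    · simpa [hi] using h i
    · simpa [hi] using h i

/-- Vectors of `ℂ^(n+1)` whose coordinates are imaginary on `I` and real off `I`. -/
def IsMixedReal (I : Finset (Fin (n + 1))) (v : CSpace n) : Prop :=
  (∀ i ∈ I, (v i).re = 0) ∧ ∀ i ∉ I, (v i).im = 0

theorem isMixedReal_toQuadric {I : Finset (Fin (n + 1))} {p : RSpace n × RSpace n}
    (hp : p ∈ coordinateConormal I) : IsMixedReal I (toQuadric p) :=
  ⟨fun i hi => by rw [re_toQuadric, hp.2.1 i hi, mul_zero],
    fun i hi => by rw [im_toQuadric, hp.2.2 i hi, mul_zero]⟩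

theorem isMixedReal_fderiv {I : Finset (Fin (n + 1))} {p v : RSpace n × RSpace n}
    (hv : v ∈ tangentVectors (coordinateConormal I) p) :
    IsMixedReal I (fderiv ℝ toQuadric p v) := by
  refine ⟨fun i hi => ?_, fun i hi => ?_⟩
  · exact apply_fderiv_toQuadric hv (Complex.reCLM.comp
      ((EuclideanSpace.proj i : CSpace n →L[ℂ] ℂ).restrictScalars ℝ))
      fun q hq => (isMixedReal_toQuadric hq).1 i hi
  · exact apply_fderiv_toQuadric hv (Complex.imCLM.comp
      ((EuclideanSpace.proj i : CSpace n →L[ℂ] ℂ).restrictScalars ℝ))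
      fun q hq => (isMixedReal_toQuadric hq).2 i hi

theorem IsMixedReal.im_sum {I : Finset (Fin (n + 1))} {v w : CSpace n} (hv : IsMixedReal I v)
    (hw : IsMixedReal I w) : (∑ i, v i * (starRingEnd ℂ) (w i)).im = 0 := by
  rw [Complex.im_sum]
  refine Finset.sum_eq_zero fun i _ => ?_
  by_cases hi : i ∈ I
  · simp [hv.1 i hi, hw.1 i hi]
  · simp [hv.2 i hi, hw.2 i hi]

theorem IsMixedReal.im_kahlerPairing {I : Finset (Fin (n + 1))} (u : ℝ → ℝ) {z v w : CSpace n}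
    (hz : IsMixedReal I z) (hv : IsMixedReal I v) (hw : IsMixedReal I w) :
    (kahlerPairing u z v w).im = 0 := by
  simp [kahlerPairing, Complex.mul_im, hv.im_sum hw, hv.im_sum hz, hz.im_sum hw]

open Matrix in
-- Pulling the factor i out of the columns in I leaves a real determinant times i^|I|, which is ±1
-- for even |I|.
theorem im_det_of_isMixedReal {I : Finset (Fin (n + 1))} (hI : Even I.card)
    {M : Fin (n + 1) → CSpace n} (hM : ∀ i, IsMixedReal I (M i)) :
    (det (of fun i j => M i j)).im = 0 := by
  let N : Matrix (Fin (n + 1)) (Fin (n + 1)) ℝ :=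
    of fun i j => if j ∈ I then (M i j).im else (M i j).re
  have h : (of fun i j => M i j) = of fun i j =>
      (if j ∈ I then Complex.I else 1) * (Complex.ofRealHom.mapMatrix N) i j := by
    ext i j
    by_cases hj : j ∈ I
    · apply Complex.ext <;> simp [N, hj, (hM i).1 j hj]
    · apply Complex.ext <;> simp [N, hj, (hM i).2 j hj]
  rw [h, det_mul_row (fun j => if j ∈ I then Complex.I else 1), ← RingHom.map_det,
    Finset.prod_ite_mem, Finset.univ_inter, Finset.prod_const]
  obtain ⟨m, hm⟩ := hI
  rw [hm, ← two_mul, pow_mul, Complex.I_sq, show ((-1 : ℂ)) = ((-1 : ℝ) : ℂ) by simp,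
    ← Complex.ofReal_pow, Complex.ofRealHom_eq_coe, ← Complex.ofReal_mul, Complex.ofReal_im]

theorem isSpecialLagrangian_coordinateConormal {c : ℝ} {u : ℝ → ℝ}
    (hu : IsStenzelPotential n c u) (hc : 0 < c) (hn : n ≠ 0) {I : Finset (Fin (n + 1))}
    (hI : Even I.card) : IsSpecialLagrangian c u (coordinateConormal I) := by
  refine isSpecialLagrangian_of_im_eq_zero hu hc hn (coordinateConormal_subset I)
    (isSubmanifold_coordinateConormal I) (fun p hp v hv w hw => ?_) fun p hp v hv => ?_
  · exact (isMixedReal_toQuadric hp).im_kahlerPairing u (isMixedReal_fderiv hv)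
      (isMixedReal_fderiv hw)
  · refine im_det_of_isMixedReal hI (Fin.cases ?_ fun i => ?_)
    · exact isMixedReal_toQuadric hp
    · exact isMixedReal_fderiv (hv i)

/-- The bundle is the image of (unit sphere of the coordinates off I) × ℝ^(n+1). The bound on |I|
keeps that sphere at dimension at least 1, hence connected. -/
theorem isConnected_coordinateConormal {I : Finset (Fin (n + 1))} (hI : I.card < n) :
    IsConnected (coordinateConormal I) := by
  have hW : 1 < Module.rank ℝ (EuclideanSpace ℝ {i // i ∉ I}) := by
    rw [← Module.finrank_eq_rank, finrank_euclideanSpace, Fintype.card_subtype_compl,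
      Fintype.card_fin, Fintype.card_coe]
    exact_mod_cast (by omega : 1 < n + 1 - I.card)
  let f : EuclideanSpace ℝ {i // i ∉ I} × RSpace n → RSpace n × RSpace n := fun q =>
    (WithLp.toLp 2 fun i => if h : i ∉ I then q.1 ⟨i, h⟩ else 0,
      WithLp.toLp 2 fun i => if i ∈ I then q.2 i else 0)
  have hf : Continuous f := by
    refine Continuous.prodMk ((PiLp.continuous_toLp 2 _).comp (continuous_pi fun i => ?_))
      ((PiLp.continuous_toLp 2 _).comp (continuous_pi fun i => ?_))
    · split_ifs
      · fun_prop
      · fun_prop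
    · by_cases hi : i ∈ I
      · simp only [hi, if_true]
        fun_prop
      · simp only [hi, if_false]
        fun_prop
  have hnorm (q :
      EuclideanSpace ℝ {i // i ∉ I} × RSpace n) : ‖(f q).1‖ = ‖q.1‖ := by
    rw [← sq_eq_sq₀ (norm_nonneg _) (norm_nonneg _), EuclideanSpace.real_norm_sq_eq,
      EuclideanSpace.real_norm_sq_eq]
    have h0 (i : {i // ¬ i ∉ I}) : (f q).1 i ^ 2 = 0 := by simp [f, not_not.1 i.2]
    have h1 (i : {i // i ∉ I}) : (f q).1 i ^ 2 = q.1 i ^ 2 := by simp [f, i.2]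
    rw [← Fintype.sum_subtype_add_sum_subtype (fun i => i ∉ I), Finset.sum_congr rfl fun i _ => h1 i,
      Finset.sum_eq_zero fun i _ => h0 i, add_zero]
  have himage : coordinateConormal I = f '' (Metric.sphere 0 1 ×ˢ Set.univ) := by
    ext p
    constructor
    · rintro ⟨h1, h2, h3⟩
      have hfp : f (WithLp.toLp 2 fun i => p.1 i, p.2) = p := by
        refine Prod.ext (PiLp.ext fun i => ?_) (PiLp.ext fun i => ?_)
        · by_cases hi : i ∈ I
          · simp [f, hi, h2 i hi]
          · simp [f, hi]
        · by_cases hi : i ∈ I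
          · simp [f, hi]
          · simp [f, hi, h3 i hi]
      refine ⟨_, ⟨?_, trivial⟩, hfp⟩
      rw [mem_sphere_zero_iff_norm, ← hnorm, hfp, h1]
    · rintro ⟨q, ⟨hq, -⟩, rfl⟩
      refine ⟨?_, fun i hi => ?_, fun i hi => ?_⟩
      · rw [hnorm, mem_sphere_zero_iff_norm.1 hq]
      · simp [f, hi]
      · simp [f, hi]
  rw [himage]
  exact ((isConnected_sphere hW 0 zero_le_one).prod isConnected_univ).image f hf.continuousOn

/-- Reindexing of the coordinates of both components. -/
def permCoords (σ : Equiv.Perm (Fin (n + 1))) (p : RSpace n × RSpace n) : RSpace n × RSpace n :=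
  (WithLp.toLp 2 fun i => p.1 (σ i), WithLp.toLp 2 fun i => p.2 (σ i))

theorem contDiff_permCoords (σ : Equiv.Perm (Fin (n + 1))) :
    ContDiff ℝ ∞ (permCoords σ) := by
  refine ContDiff.prodMk ((contDiff_piLp 2).2 fun i => ?_) ((contDiff_piLp 2).2 fun i => ?_)
  · simp only
    fun_prop
  · simp only
    fun_prop

theorem norm_permCoords_fst (σ : Equiv.Perm (Fin (n + 1))) (p : RSpace n × RSpace n) :
    ‖(permCoords σ p).1‖ = ‖p.1‖ := by
  rw [← sq_eq_sq₀ (norm_nonneg _) (norm_nonneg _), EuclideanSpace.real_norm_sq_eq,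
    EuclideanSpace.real_norm_sq_eq]
  exact Equiv.sum_comp σ fun i => p.1 i ^ 2

theorem mapsTo_permCoords {σ : Equiv.Perm (Fin (n + 1))} {I J : Finset (Fin (n + 1))}
    (h : ∀ i, i ∈ J ↔ σ i ∈ I) :
    Set.MapsTo (permCoords σ) (coordinateConormal I) (coordinateConormal J) :=
  fun p hp => ⟨by rw [norm_permCoords_fst, hp.1], fun i hi => hp.2.1 _ ((h i).1 hi),
    fun i hi => hp.2.2 _ fun h' => hi ((h i).2 h')⟩

theorem areDiffeomorphic_coordinateConormal {σ : Equiv.Perm (Fin (n + 1))}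
    {I J : Finset (Fin (n + 1))} (h : ∀ i, i ∈ J ↔ σ i ∈ I) :
    AreDiffeomorphic (coordinateConormal I) (coordinateConormal J) := by
  refine ⟨permCoords σ, permCoords σ.symm, (contDiff_permCoords σ).contDiffOn,
    (contDiff_permCoords _).contDiffOn, mapsTo_permCoords h,
    mapsTo_permCoords fun i => ?_, fun p _ => ?_, fun p _ => ?_⟩
  · rw [h, Equiv.apply_symm_apply]
  · exact Prod.ext (PiLp.ext fun i => by simp [permCoords]) (PiLp.ext fun i => by simp [permCoords])
  · exact Prod.ext (PiLp.ext fun i => by simp [permCoords]) (PiLp.ext fun i => by simp [permCoords])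

theorem areDiffeomorphic_coordinateConormal_empty :
    AreDiffeomorphic (coordinateConormal (∅ : Finset (Fin (n + 1))))
      (Metric.sphere (0 : RSpace n) 1) := by
  refine ⟨Prod.fst, fun x => (x, 0), contDiff_fst.contDiffOn,
    (contDiff_id.prodMk contDiff_const).contDiffOn, fun p hp => ?_, fun x hx => ?_,
    fun p hp => ?_, fun x _ => rfl⟩
  · exact mem_sphere_zero_iff_norm.2 hp.1
  · exact ⟨mem_sphere_zero_iff_norm.1 hx, by simp, by simp⟩
  · exact Prod.ext rfl (PiLp.ext fun i => (hp.2.2 i (Finset.notMem_empty i)).symm)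

/-- Great circles are smooth curves on great spheres. -/
theorem mem_tangentVectors_greatSphere {k : ℕ} {x w : RSpace n} (hx : x ∈ greatSphere n k)
    (hw : w ∈ greatSphere n k) (hxw : inner ℝ x w = 0) :
    w ∈ tangentVectors (greatSphere n k) x := by
  refine ⟨fun t => Real.cos t • x + Real.sin t • w, ?_, by simp, ?_, ?_⟩
  · exact ((Real.contDiff_cos.smul contDiff_const).add
      (Real.contDiff_sin.smul contDiff_const)).contDiffAt
  · refine Filter.Eventually.of_forall fun t => ⟨?_, fun i hi => ?_⟩
    · rw [← sq_eq_sq₀ (norm_nonneg _) zero_le_one, norm_add_sq_real, norm_smul, norm_smul,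
        inner_smul_left, inner_smul_right, hxw, hx.1, hw.1]
      simp
    · simp [hx.2 i hi, hw.2 i hi]
  · simpa using ((Real.hasDerivAt_cos 0).smul_const x).fun_add ((Real.hasDerivAt_sin 0).smul_const w)

/-- Tangent curves keep the last coordinates 0, which gives one inclusion. For the other it is
enough to test ξ against great circles. -/
theorem conormalBundle_greatSphere (k : ℕ) :
    conormalBundle (greatSphere n k) =
      coordinateConormal (Finset.univ.filter fun i : Fin (n + 1) => k < (i : ℕ)) := by
  ext ⟨x, ξ⟩
  constructor
  · rintro ⟨⟨h1, h2⟩, h3, h4⟩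
    refine ⟨h1, fun i hi => h3.2 i (by simpa using hi), fun i hi => ?_⟩
    replace hi : ¬ k < (i : ℕ) := by simpa using hi
    set e : RSpace n := EuclideanSpace.single i 1 with he
    -- The tangential projection of the basis vector; as x ⊥ ξ, its pairing with ξ is still ξ_i.
    set v : RSpace n := e - x i • x with hv
    have hev : inner ℝ v ξ = ξ i := by
      rw [hv, inner_sub_left, inner_smul_left, h2, mul_zero, sub_zero, he]
      simp [EuclideanSpace.inner_single_left]
    rw [← hev]
    rcases eq_or_ne v 0 with h0 | h0
    · rw [h0, inner_zero_left]
    have hxv : inner ℝ x v = 0 := by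
      rw [hv, inner_sub_right, inner_smul_right, real_inner_self_eq_norm_sq, h1, he]
      simp [EuclideanSpace.inner_single_right]
    have hmem : ‖v‖⁻¹ • v ∈ tangentVectors (greatSphere n k) x := by
      refine mem_tangentVectors_greatSphere h3 ⟨norm_smul_inv_norm (𝕜 := ℝ) h0, fun j hj => ?_⟩ ?_
      · have hij : j ≠ i := by
          rintro rfl
          exact hi hj
        have hxj : x j = 0 := h3.2 j hj
        simp [hv, he, hxj, hij]
      · rw [inner_smul_right, hxv, mul_zero]
    have := h4 _ hmem
    rw [inner_smul_left] at this
    simpa [h0] using this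
  · intro hp
    have h2 := hp.2.1
    have h3 := hp.2.2
    simp only [Finset.mem_filter, Finset.mem_univ, true_and] at h2 h3
    refine ⟨coordinateConormal_subset _ hp, ⟨hp.1, h2⟩, ?_⟩
    rintro v ⟨γ, -, -, hS, hγ⟩
    rw [inner_eq_sum]
    refine Finset.sum_eq_zero fun i _ => ?_
    by_cases hi : k < (i : ℕ)
    · have h := (EuclideanSpace.proj i : RSpace n →L[ℝ] ℝ).hasFDerivAt.comp_hasDerivAt (0 : ℝ) hγ
      have h0 : v i = 0 := h.unique ((hasDerivAt_const (0 : ℝ) (0 : ℝ)).congr_of_eventuallyEq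
        (hS.mono fun t ht => ht.2 i hi))
      rw [h0, zero_mul]
    · rw [show (x, ξ).2 i = 0 from h3 i hi, mul_zero]

end CoordinateConormal

/-! ### The moment map on rotation generators, and normal forms under H. -/

theorem momentMap_rotationGenerator {n : ℕ} (u : ℝ → ℝ) (p : RSpace n × RSpace n)
    (i j : Fin (n + 1)) :
    momentMap u p (rotationGenerator i j) = deriv u (‖toQuadric p‖ ^ 2) *
      (-2 * ((toQuadric p j).im * (toQuadric p i).re - (toQuadric p j).re * (toQuadric p i).im)) := by
  have h : ∀ k, ∑ l, ((rotationGenerator i j k l : ℝ) : ℂ) * toQuadric p l =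
      (if j = k then toQuadric p i else 0) - if i = k then toQuadric p j else 0 := fun k => by
    by_cases hj : j = k <;> by_cases hi : i = k <;>
      simp [rotationGenerator, Matrix.single_apply, apply_ite Complex.ofReal, hi, hj]
  rw [momentMap]
  simp only [h, map_sub, mul_sub, Finset.sum_sub_distrib, apply_ite (starRingEnd ℂ), map_zero,
    mul_ite, mul_zero, Finset.sum_ite_eq, Finset.mem_univ, if_true]
  simp
  ring

theorem exists_polar (x y : ℝ) : ∃ r c s : ℝ, c ^ 2 + s ^ 2 = 1 ∧ x = r * c ∧ y = r * s := by
  refine ⟨‖(⟨x, y⟩ : ℂ)‖, Real.cos (Complex.arg ⟨x, y⟩), Real.sin (Complex.arg ⟨x, y⟩),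
    Real.cos_sq_add_sin_sq _, ?_, ?_⟩
  · rw [Complex.norm_mul_cos_arg]
  · rw [Complex.norm_mul_sin_arg]

/-- Two orthogonal vectors of the plane are the images of (a, 0) and (0, p) under one rotation,
because signs of a and p are allowed. This brings a plane block of (x, ξ) into the slice. -/
theorem exists_orthogonal_polar {x y ξ η : ℝ} (h : x * ξ + y * η = 0) :
    ∃ a p c s : ℝ, c ^ 2 + s ^ 2 = 1 ∧ x = a * c ∧ y = a * s ∧ ξ = -(p * s) ∧ η = p * c := by
  by_cases hxy : x = 0 ∧ y = 0
  · obtain ⟨r, c, s, hcs, h1, h2⟩ := exists_polar η (-ξ)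
    exact ⟨0, r, c, s, hcs, by simp [hxy.1], by simp [hxy.2], by linarith, h1⟩
  · obtain ⟨r, c, s, hcs, h1, h2⟩ := exists_polar x y
    have hr : r ≠ 0 := by
      rintro rfl
      exact hxy ⟨by simpa using h1, by simpa using h2⟩
    have h3 : c * ξ + s * η = 0 := by
      apply mul_left_cancel₀ hr
      linear_combination h - ξ * h1 - η * h2
    exact ⟨r, c * η - s * ξ, c, s, hcs, h1, h2,
      by linear_combination (-ξ) * hcs + c * h3, by linear_combination (-η) * hcs + s * h3⟩

theorem exists_spherical (x y z : ℝ) :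
    ∃ r a b c s : ℝ, a ^ 2 + b ^ 2 = 1 ∧ c ^ 2 + s ^ 2 = 1 ∧
      x = r * a ∧ y = r * (b * c) ∧ z = r * (b * s) := by
  obtain ⟨t, c, s, hcs, h1, h2⟩ := exists_polar y z
  obtain ⟨r, a, b, hab, h3, h4⟩ := exists_polar x t
  exact ⟨r, a, b, c, s, hab, hcs, h3, by rw [h1, h4]; ring, by rw [h2, h4]; ring⟩

theorem rotation_mem {c s : ℝ} (h : c ^ 2 + s ^ 2 = 1) :
    !![c, -s; s, c] ∈ Matrix.specialOrthogonalGroup (Fin 2) ℝ := by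
  rw [Matrix.mem_specialOrthogonalGroup_iff, Matrix.mem_orthogonalGroup_iff]
  constructor
  · ext i j
    fin_cases i <;> fin_cases j <;> simp [Matrix.mul_apply, Fin.sum_univ_two] <;> linarith
  · rw [Matrix.det_fin_two_of]
    linarith

theorem eq_rotation_of_mem {h : Matrix (Fin 2) (Fin 2) ℝ}
    (hh : h ∈ Matrix.specialOrthogonalGroup (Fin 2) ℝ) :
    h 0 0 ^ 2 + h 1 0 ^ 2 = 1 ∧ h 0 1 = -h 1 0 ∧ h 1 1 = h 0 0 := by
  rw [Matrix.mem_specialOrthogonalGroup_iff, Matrix.mem_orthogonalGroup_iff', Matrix.det_fin_two]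
    at hh
  obtain ⟨h1, h2⟩ := hh
  have h00 := congrFun (congrFun h1 0) 0
  have h11 := congrFun (congrFun h1 1) 1
  simp [Matrix.mul_apply, Fin.sum_univ_two] at h00 h11
  have h3 : (h 1 1 - h 0 0) ^ 2 + (h 0 1 + h 1 0) ^ 2 = 0 := by
    linear_combination h00 + h11 - 2 * h2
  have h4 : h 1 1 - h 0 0 = 0 := by nlinarith [sq_nonneg (h 1 1 - h 0 0), sq_nonneg (h 0 1 + h 1 0)]
  have h5 : h 0 1 + h 1 0 = 0 := by nlinarith [sq_nonneg (h 1 1 - h 0 0), sq_nonneg (h 0 1 + h 1 0)]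
  exact ⟨by linarith, by linarith, by linarith⟩

/-- With spherical coordinates for the first column, this shows that SO(3) is transitive on the unit
sphere. -/
theorem spherical_rotation_mem {a b c s : ℝ} (h : a ^ 2 + b ^ 2 = 1) (h' : c ^ 2 + s ^ 2 = 1) :
    !![a, -b, 0; b * c, a * c, -s; b * s, a * s, c] ∈ Matrix.specialOrthogonalGroup (Fin 3) ℝ := by
  rw [Matrix.mem_specialOrthogonalGroup_iff, Matrix.mem_orthogonalGroup_iff]
  constructor
  · ext i j
    fin_cases i <;> fin_cases j <;> simp [Matrix.mul_apply, Fin.sum_univ_three]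
    · linear_combination h
    · ring
    · ring
    · ring
    · linear_combination c ^ 2 * h + h'
    · linear_combination c * s * h
    · ring
    · linear_combination c * s * h
    · linear_combination s ^ 2 * h + h'
  · rw [Matrix.det_fin_three]
    simp
    linear_combination (c ^ 2 + s ^ 2) * h + h'

theorem sum_sq_column_of_mem {h : Matrix (Fin 3) (Fin 3) ℝ}
    (hh : h ∈ Matrix.specialOrthogonalGroup (Fin 3) ℝ) :
    h 0 0 ^ 2 + h 1 0 ^ 2 + h 2 0 ^ 2 = 1 := by
  rw [Matrix.mem_specialOrthogonalGroup_iff, Matrix.mem_orthogonalGroup_iff'] at hh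
  have h00 := congrFun (congrFun hh.1 0) 0
  simp [Matrix.mul_apply, Fin.sum_univ_three] at h00
  linear_combination h00

/-- The point of the slice `L̂` with coordinates `x₁, x₃, x₅, ξ₂, ξ₄`. -/
def slicePoint (a b e p q : ℝ) : RSpace 6 × RSpace 6 :=
  (!₂[a, 0, b, 0, e, 0, 0], !₂[0, p, 0, q, 0, 0, 0])

/-- The image of a point of the slice under a block rotation. -/
def orbitPoint (a b e p q c₁ s₁ c₂ s₂ w₀ w₁ w₂ : ℝ) : RSpace 6 × RSpace 6 :=
  (!₂[a * c₁, a * s₁, b * c₂, b * s₂, e * w₀, e * w₁, e * w₂],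
    !₂[-(p * s₁), p * c₁, -(q * s₂), q * c₂, 0, 0, 0])

theorem eq_slicePoint {p : RSpace 6 × RSpace 6} (hp : p ∈ subbundleL) :
    p = slicePoint (p.1 0) (p.1 2) (p.1 4) (p.2 1) (p.2 3) := by
  obtain ⟨⟨-, h1, h3, h5, h6, k0, k2, k4⟩, k5, k6⟩ := hp
  refine Prod.ext (PiLp.ext fun i => ?_) (PiLp.ext fun i => ?_)
  · fin_cases i <;> simp [slicePoint, *]
  · fin_cases i <;> simp [slicePoint, *]

theorem slicePoint_mem {a b e : ℝ} (h : a ^ 2 + b ^ 2 + e ^ 2 = 1) (p q : ℝ) :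
    slicePoint a b e p q ∈ subbundleL := by
  refine ⟨⟨?_, ?_⟩, ?_⟩
  · rw [← sq_eq_sq₀ (norm_nonneg _) zero_le_one, EuclideanSpace.real_norm_sq_eq]
    simp [slicePoint, Fin.sum_univ_succ]
    linarith
  · simp [slicePoint]
  · simp [slicePoint]

theorem sum_sq_of_mem_subbundleL {p : RSpace 6 × RSpace 6} (hp : p ∈ subbundleL) :
    p.1 0 ^ 2 + p.1 2 ^ 2 + p.1 4 ^ 2 = 1 := by
  have h := EuclideanSpace.real_norm_sq_eq p.1
  obtain ⟨⟨h0, h1, h3, h5, h6, -⟩, -⟩ := hp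
  simp [h0, h1, h3, h5, h6, Fin.sum_univ_seven] at h
  linarith

theorem act_slicePoint {h₁ h₂ : Matrix (Fin 2) (Fin 2) ℝ} (h₃ : Matrix (Fin 3) (Fin 3) ℝ)
    (hh₁ : h₁ 0 1 = -h₁ 1 0 ∧ h₁ 1 1 = h₁ 0 0) (hh₂ : h₂ 0 1 = -h₂ 1 0 ∧ h₂ 1 1 = h₂ 0 0)
    (a b e p q : ℝ) :
    act (blockMatrix h₁ h₂ h₃) (slicePoint a b e p q) =
      orbitPoint a b e p q (h₁ 0 0) (h₁ 1 0) (h₂ 0 0) (h₂ 1 0) (h₃ 0 0) (h₃ 1 0) (h₃ 2 0) := by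
  refine Prod.ext (PiLp.ext fun i => ?_) (PiLp.ext fun i => ?_)
  · fin_cases i <;> simp [act, blockMatrix, slicePoint, orbitPoint]
  · fin_cases i <;> simp [act, blockMatrix, slicePoint, orbitPoint, hh₁, hh₂]

/-- On the slice an element of H acts only through the first columns of its blocks: in SO(2) the
first column determines the second, and in the last block only x₅ can be nonzero. So an orbit is
parametrized by two unit vectors of the plane and one of ℝ³. -/
theorem mem_sweep_iff {S : Set (RSpace 6 × RSpace 6)} (hS : S ⊆ subbundleL)
    {x : RSpace 6 × RSpace 6} :
    x ∈ sweep S ↔ ∃ a b e p q c₁ s₁ c₂ s₂ w₀ w₁ w₂ : ℝ, slicePoint a b e p q ∈ S ∧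
      c₁ ^ 2 + s₁ ^ 2 = 1 ∧ c₂ ^ 2 + s₂ ^ 2 = 1 ∧ w₀ ^ 2 + w₁ ^ 2 + w₂ ^ 2 = 1 ∧
      x = orbitPoint a b e p q c₁ s₁ c₂ s₂ w₀ w₁ w₂ := by
  constructor
  · rintro ⟨A, ⟨h₁, hh₁, h₂, hh₂, h₃, hh₃, rfl⟩, y, hy, rfl⟩
    have h1 := eq_rotation_of_mem hh₁
    have h2 := eq_rotation_of_mem hh₂
    have hy' := eq_slicePoint (hS hy)
    refine ⟨_, _, _, _, _, _, _, _, _, _, _, _, hy' ▸ hy, h1.1, h2.1, sum_sq_column_of_mem hh₃, ?_⟩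
    rw [← act_slicePoint h₃ h1.2 h2.2, ← hy']
  · rintro ⟨a, b, e, p, q, c₁, s₁, c₂, s₂, w₀, w₁, w₂, hS, h1, h2, h3, rfl⟩
    obtain ⟨r, α, β, γ, σ, hαβ, hγσ, e0, e1, e2⟩ := exists_spherical w₀ w₁ w₂
    have hr : r ^ 2 = 1 := by
      rw [e0, e1, e2] at h3
      linear_combination h3 - r ^ 2 * hαβ - r ^ 2 * β ^ 2 * hγσ
    -- The radius r may be -1, so it is absorbed into the polar coordinates.
    have hαβ' : (r * α) ^ 2 + (r * β) ^ 2 = 1 := by linear_combination r ^ 2 * hαβ + hr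
    refine ⟨_, ⟨_, rotation_mem h1, _, rotation_mem h2, _,
      spherical_rotation_mem hαβ' hγσ, rfl⟩, _, hS, ?_⟩
    rw [act_slicePoint _ (by simp) (by simp)]
    simp [e0, e1, e2, mul_assoc]

theorem exists_eq_orbitPoint {x : RSpace 6 × RSpace 6} (hx : ‖x.1‖ = 1)
    (h1 : x.1 0 * x.2 0 + x.1 1 * x.2 1 = 0) (h2 : x.1 2 * x.2 2 + x.1 3 * x.2 3 = 0)
    (h4 : x.2 4 = 0) (h5 : x.2 5 = 0) (h6 : x.2 6 = 0) :
    ∃ a b e p q c₁ s₁ c₂ s₂ w₀ w₁ w₂ : ℝ, a ^ 2 + b ^ 2 + e ^ 2 = 1 ∧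
      c₁ ^ 2 + s₁ ^ 2 = 1 ∧ c₂ ^ 2 + s₂ ^ 2 = 1 ∧ w₀ ^ 2 + w₁ ^ 2 + w₂ ^ 2 = 1 ∧
      x = orbitPoint a b e p q c₁ s₁ c₂ s₂ w₀ w₁ w₂ := by
  obtain ⟨a, p, c₁, s₁, hcs₁, ha0, ha1, hp0, hp1⟩ := exists_orthogonal_polar h1
  obtain ⟨b, q, c₂, s₂, hcs₂, hb0, hb1, hq0, hq1⟩ := exists_orthogonal_polar h2
  obtain ⟨e, α, β, γ, σ, hαβ, hγσ, e0, e1, e2⟩ := exists_spherical (x.1 4) (x.1 5) (x.1 6)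
  have hw : α ^ 2 + (β * γ) ^ 2 + (β * σ) ^ 2 = 1 := by linear_combination hαβ + β ^ 2 * hγσ
  refine ⟨a, b, e, p, q, c₁, s₁, c₂, s₂, α, β * γ, β * σ, ?_, hcs₁, hcs₂, hw, ?_⟩
  · have h := EuclideanSpace.real_norm_sq_eq x.1
    rw [hx, Fin.sum_univ_seven, ha0, ha1, hb0, hb1, e0, e1, e2] at h
    linear_combination -h - a ^ 2 * hcs₁ - b ^ 2 * hcs₂ - e ^ 2 * hw
  · refine Prod.ext (PiLp.ext fun i => ?_) (PiLp.ext fun i => ?_)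
    · fin_cases i <;> simp [orbitPoint, *]
    · fin_cases i <;> simp [orbitPoint, *]

theorem norm_orbitPoint_fst {a b e c₁ s₁ c₂ s₂ w₀ w₁ w₂ : ℝ} (p q : ℝ)
    (h : a ^ 2 + b ^ 2 + e ^ 2 = 1) (h₁ : c₁ ^ 2 + s₁ ^ 2 = 1) (h₂ : c₂ ^ 2 + s₂ ^ 2 = 1)
    (hw : w₀ ^ 2 + w₁ ^ 2 + w₂ ^ 2 = 1) :
    ‖(orbitPoint a b e p q c₁ s₁ c₂ s₂ w₀ w₁ w₂).1‖ = 1 := by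
  rw [← sq_eq_sq₀ (norm_nonneg _) zero_le_one, EuclideanSpace.real_norm_sq_eq,
    Fin.sum_univ_seven]
  simp [orbitPoint]
  linear_combination a ^ 2 * h₁ + b ^ 2 * h₂ + e ^ 2 * hw + h

theorem slicePoint_mem_iff {a b e p q : ℝ} :
    slicePoint a b e p q ∈ subbundleL ↔ a ^ 2 + b ^ 2 + e ^ 2 = 1 :=
  ⟨fun h => by simpa [slicePoint] using sum_sq_of_mem_subbundleL h, fun h => slicePoint_mem h p q⟩

theorem eq_zero_of_mul_unit {r c s : ℝ} (h : c ^ 2 + s ^ 2 = 1) (hc : r * c = 0) (hs : r * s = 0) :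
    r = 0 := by
  linear_combination (-r) * h + c * hc + s * hs

/-! ### The sweeps of the five pieces. -/

theorem sweep_pieceSphere : sweep pieceSphere = coordinateConormal ∅ := by
  ext x
  rw [mem_sweep_iff (S := pieceSphere) fun y hy => hy.1]
  constructor
  · rintro ⟨a, b, e, p, q, c₁, s₁, c₂, s₂, w₀, w₁, w₂, ⟨hS, h0⟩, h1, h2, h3, rfl⟩
    have hp : p = 0 := by simpa [slicePoint] using congrArg (fun y : RSpace 6 => y 1) h0
    have hq : q = 0 := by simpa [slicePoint] using congrArg (fun y : RSpace 6 => y 3) h0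
    refine ⟨norm_orbitPoint_fst _ _ (slicePoint_mem_iff.1 hS) h1 h2 h3, by simp, fun i _ => ?_⟩
    fin_cases i <;> simp [orbitPoint, hp, hq]
  · rintro ⟨h1, -, h3⟩
    replace h3 : ∀ i, x.2 i = 0 := fun i => h3 i (Finset.notMem_empty i)
    obtain ⟨a, b, e, p, q, c₁, s₁, c₂, s₂, w₀, w₁, w₂, h, hc₁, hc₂, hw, rfl⟩ :=
      exists_eq_orbitPoint h1 (by simp [h3]) (by simp [h3]) (h3 _) (h3 _) (h3 _)
    have hp : p = 0 := eq_zero_of_mul_unit hc₁ (by simpa [orbitPoint] using h3 1)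
      (by simpa [orbitPoint] using h3 0)
    have hq : q = 0 := eq_zero_of_mul_unit hc₂ (by simpa [orbitPoint] using h3 3)
      (by simpa [orbitPoint] using h3 2)
    refine ⟨a, b, e, p, q, c₁, s₁, c₂, s₂, w₀, w₁, w₂, ⟨slicePoint_mem h _ _, ?_⟩, hc₁, hc₂, hw, rfl⟩
    refine PiLp.ext fun i => ?_
    fin_cases i <;> simp [slicePoint, hp, hq]

theorem sweep_pieceCylinderOne : sweep pieceCylinderOne = coordinateConormal {0, 1} := by
  ext x
  rw [mem_sweep_iff (S := pieceCylinderOne) fun y hy => hy.1]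
  constructor
  · rintro ⟨a, b, e, p, q, c₁, s₁, c₂, s₂, w₀, w₁, w₂, ⟨hS, ha, hq⟩, h1, h2, h3, rfl⟩
    replace ha : a = 0 := by simpa [slicePoint] using ha
    replace hq : q = 0 := by simpa [slicePoint] using hq
    refine ⟨norm_orbitPoint_fst _ _ (slicePoint_mem_iff.1 hS) h1 h2 h3, by simp [orbitPoint, ha],
      fun i => ?_⟩
    fin_cases i <;> simp [orbitPoint, hq]
  · rintro ⟨h1, h2, h3⟩
    obtain ⟨a, b, e, p, q, c₁, s₁, c₂, s₂, w₀, w₁, w₂, h, hc₁, hc₂, hw, rfl⟩ :=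
      exists_eq_orbitPoint h1 (by simp [h2]) (by simp [h3]) (h3 _ (by decide)) (h3 _ (by decide))
        (h3 _ (by decide))
    have ha : a = 0 := eq_zero_of_mul_unit hc₁ (by simpa [orbitPoint] using h2 0 (by decide))
      (by simpa [orbitPoint] using h2 1 (by decide))
    have hq : q = 0 := eq_zero_of_mul_unit hc₂ (by simpa [orbitPoint] using h3 3 (by decide))
      (by simpa [orbitPoint] using h3 2 (by decide))
    exact ⟨a, b, e, p, q, c₁, s₁, c₂, s₂, w₀, w₁, w₂, ⟨slicePoint_mem h _ _, by simp [slicePoint, ha],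
      by simp [slicePoint, hq]⟩, hc₁, hc₂, hw, rfl⟩

theorem sweep_pieceCylinderThree : sweep pieceCylinderThree = coordinateConormal {2, 3} := by
  ext x
  rw [mem_sweep_iff (S := pieceCylinderThree) fun y hy => hy.1]
  constructor
  · rintro ⟨a, b, e, p, q, c₁, s₁, c₂, s₂, w₀, w₁, w₂, ⟨hS, hb, hp⟩, h1, h2, h3, rfl⟩
    replace hb : b = 0 := by simpa [slicePoint] using hb
    replace hp : p = 0 := by simpa [slicePoint] using hp
    refine ⟨norm_orbitPoint_fst _ _ (slicePoint_mem_iff.1 hS) h1 h2 h3, by simp [orbitPoint, hb],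
      fun i => ?_⟩
    fin_cases i <;> simp [orbitPoint, hp]
  · rintro ⟨h1, h2, h3⟩
    obtain ⟨a, b, e, p, q, c₁, s₁, c₂, s₂, w₀, w₁, w₂, h, hc₁, hc₂, hw, rfl⟩ :=
      exists_eq_orbitPoint h1 (by simp [h3]) (by simp [h2]) (h3 _ (by decide)) (h3 _ (by decide))
        (h3 _ (by decide))
    have hb : b = 0 := eq_zero_of_mul_unit hc₂ (by simpa [orbitPoint] using h2 2 (by decide))
      (by simpa [orbitPoint] using h2 3 (by decide))
    have hp : p = 0 := eq_zero_of_mul_unit hc₁ (by simpa [orbitPoint] using h3 1 (by decide))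
      (by simpa [orbitPoint] using h3 0 (by decide))
    exact ⟨a, b, e, p, q, c₁, s₁, c₂, s₂, w₀, w₁, w₂, ⟨slicePoint_mem h _ _, by simp [slicePoint, hb],
      by simp [slicePoint, hp]⟩, hc₁, hc₂, hw, rfl⟩

theorem sweep_piecePlane {ε : ℝ} (hε : ε ^ 2 = 1) :
    sweep (piecePlane ε) = coordinateConormal {0, 1, 2, 3} := by
  ext x
  rw [mem_sweep_iff (S := piecePlane ε) fun y hy => hy.1]
  constructor
  · rintro ⟨a, b, e, p, q, c₁, s₁, c₂, s₂, w₀, w₁, w₂, ⟨hS, ha, hb, -⟩, h1, h2, h3, rfl⟩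
    replace ha : a = 0 := by simpa [slicePoint] using ha
    replace hb : b = 0 := by simpa [slicePoint] using hb
    refine ⟨norm_orbitPoint_fst _ _ (slicePoint_mem_iff.1 hS) h1 h2 h3,
      by simp [orbitPoint, ha, hb], fun i => ?_⟩
    fin_cases i <;> simp [orbitPoint]
  · rintro ⟨h1, h2, h3⟩
    obtain ⟨a, b, e, p, q, c₁, s₁, c₂, s₂, w₀, w₁, w₂, h, hc₁, hc₂, hw, rfl⟩ :=
      exists_eq_orbitPoint h1 (by simp [h2]) (by simp [h2]) (h3 _ (by decide)) (h3 _ (by decide))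
        (h3 _ (by decide))
    have ha : a = 0 := eq_zero_of_mul_unit hc₁ (by simpa [orbitPoint] using h2 0 (by decide))
      (by simpa [orbitPoint] using h2 1 (by decide))
    have hb : b = 0 := eq_zero_of_mul_unit hc₂ (by simpa [orbitPoint] using h2 2 (by decide))
      (by simpa [orbitPoint] using h2 3 (by decide))
    have he : e ^ 2 = 1 := by simpa [ha, hb] using h
    -- Here e = ±1, and the sign ε·e moves into the unit vector w; this is why both signs of ε give
    -- the same sweep.
    refine ⟨a, b, ε, p, q, c₁, s₁, c₂, s₂, ε * e * w₀, ε * e * w₁, ε * e * w₂,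
      ⟨slicePoint_mem (by rw [ha, hb, hε]; norm_num) _ _, by simp [slicePoint, ha],
      by simp [slicePoint, hb], by simp [slicePoint]⟩, hc₁, hc₂, ?_, ?_⟩
    · linear_combination hε * e ^ 2 * (w₀ ^ 2 + w₁ ^ 2 + w₂ ^ 2) +
        he * (w₀ ^ 2 + w₁ ^ 2 + w₂ ^ 2) + hw
    · have h4 (w : ℝ) : ε * (ε * e * w) = e * w := by linear_combination e * w * hε
      simp only [orbitPoint, h4]

/-! ### Isotropy subgroups on the slice. -/

theorem mem_isotropy_slicePoint {h₁ h₂ : Matrix (Fin 2) (Fin 2) ℝ} {h₃ : Matrix (Fin 3) (Fin 3) ℝ}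
    (hh₁ : h₁ ∈ Matrix.specialOrthogonalGroup (Fin 2) ℝ)
    (hh₂ : h₂ ∈ Matrix.specialOrthogonalGroup (Fin 2) ℝ)
    (hh₃ : h₃ ∈ Matrix.specialOrthogonalGroup (Fin 3) ℝ) {a b e p q : ℝ} :
    blockMatrix h₁ h₂ h₃ ∈ isotropy (slicePoint a b e p q) ↔
      orbitPoint a b e p q (h₁ 0 0) (h₁ 1 0) (h₂ 0 0) (h₂ 1 0) (h₃ 0 0) (h₃ 1 0) (h₃ 2 0) =
        slicePoint a b e p q := by
  rw [isotropy, Set.mem_sep_iff,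
    act_slicePoint h₃ (eq_rotation_of_mem hh₁).2 (eq_rotation_of_mem hh₂).2]
  exact ⟨fun h => h.2, fun h => ⟨⟨h₁, hh₁, h₂, hh₂, h₃, hh₃, rfl⟩, h⟩⟩

theorem orbitPoint_eq_slicePoint_iff {a b e p q c₁ s₁ c₂ s₂ w₀ w₁ w₂ : ℝ} :
    orbitPoint a b e p q c₁ s₁ c₂ s₂ w₀ w₁ w₂ = slicePoint a b e p q ↔
      (a * c₁ = a ∧ a * s₁ = 0 ∧ p * c₁ = p ∧ p * s₁ = 0) ∧
      (b * c₂ = b ∧ b * s₂ = 0 ∧ q * c₂ = q ∧ q * s₂ = 0) ∧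
      (e * w₀ = e ∧ e * w₁ = 0 ∧ e * w₂ = 0) := by
  simp only [orbitPoint, slicePoint, Prod.mk.injEq, (WithLp.toLp_injective 2).eq_iff,
    Matrix.vecCons_inj, neg_eq_zero]
  tauto

/-- A nonzero vector in a block makes the first column of that block of any isotropy element
trivial, and such elements fix all of the slice. If a block vanishes, a half turn there (diag(-1,
-1, 1) in SO(3)) fixes the point but moves a unit vector of that block. -/
theorem slicePoint_mem_principalL_iff {a b e p q : ℝ} (h : a ^ 2 + b ^ 2 + e ^ 2 = 1) :
    slicePoint a b e p q ∈ principalL ↔ (a ≠ 0 ∨ p ≠ 0) ∧ (b ≠ 0 ∨ q ≠ 0) ∧ e ≠ 0 := by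
  have r0 := rotation_mem (c := 1) (s := 0) (by norm_num)
  have r1 := rotation_mem (c := -1) (s := 0) (by norm_num)
  have t0 := spherical_rotation_mem (a := 1) (b := 0) (c := 1) (s := 0) (by norm_num) (by norm_num)
  have t1 := spherical_rotation_mem (a := -1) (b := 0) (c := 1) (s := 0) (by norm_num) (by norm_num)
  constructor
  · rintro ⟨-, hq⟩
    refine ⟨?_, ?_, ?_⟩
    · by_contra! h0
      have := hq _ (slicePoint_mem (a := 1) (b := 0) (e := 0) (by norm_num) 0 0)
        ((mem_isotropy_slicePoint r1 r0 t0).2 (orbitPoint_eq_slicePoint_iff.2 (by simp [h0])))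
      have := orbitPoint_eq_slicePoint_iff.1 ((mem_isotropy_slicePoint r1 r0 t0).1 this)
      norm_num at this
    · by_contra! h0
      have := hq _ (slicePoint_mem (a := 0) (b := 1) (e := 0) (by norm_num) 0 0)
        ((mem_isotropy_slicePoint r0 r1 t0).2 (orbitPoint_eq_slicePoint_iff.2 (by simp [h0])))
      have := orbitPoint_eq_slicePoint_iff.1 ((mem_isotropy_slicePoint r0 r1 t0).1 this)
      norm_num at this
    · by_contra! h0
      have := hq _ (slicePoint_mem (a := 0) (b := 0) (e := 1) (by norm_num) 0 0)
        ((mem_isotropy_slicePoint r0 r0 t1).2 (orbitPoint_eq_slicePoint_iff.2 (by simp [h0])))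
      have := orbitPoint_eq_slicePoint_iff.1 ((mem_isotropy_slicePoint r0 r0 t1).1 this)
      norm_num at this
  · rintro ⟨h1, h2, h3⟩
    refine ⟨slicePoint_mem h _ _, fun y hy A hA => ?_⟩
    obtain ⟨h₁, hh₁, h₂, hh₂, h₃, hh₃, rfl⟩ := hA.1
    rw [eq_slicePoint hy]
    have hA' := orbitPoint_eq_slicePoint_iff.1 ((mem_isotropy_slicePoint hh₁ hh₂ hh₃).1 hA)
    obtain ⟨⟨a1, a2, a3, a4⟩, ⟨b1, b2, b3, b4⟩, e1, e2, e3⟩ := hA'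
    refine (mem_isotropy_slicePoint hh₁ hh₂ hh₃).2 (orbitPoint_eq_slicePoint_iff.2 ?_)
    have k1 : h₁ 0 0 = 1 ∧ h₁ 1 0 = 0 := by
      rcases h1 with h1 | h1
      · exact ⟨(mul_eq_left₀ h1).1 a1, (mul_eq_zero_iff_left h1).1 a2⟩
      · exact ⟨(mul_eq_left₀ h1).1 a3, (mul_eq_zero_iff_left h1).1 a4⟩
    have k2 : h₂ 0 0 = 1 ∧ h₂ 1 0 = 0 := by
      rcases h2 with h2 | h2
      · exact ⟨(mul_eq_left₀ h2).1 b1, (mul_eq_zero_iff_left h2).1 b2⟩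
      · exact ⟨(mul_eq_left₀ h2).1 b3, (mul_eq_zero_iff_left h2).1 b4⟩
    simp [k1, k2, (mul_eq_left₀ h3).1 e1, (mul_eq_zero_iff_left h3).1 e2,
      (mul_eq_zero_iff_left h3).1 e3]

/-! ### The levels of the moment map in the slice. -/

/-- The factor relating the moment map on `T*S^n` to `x_i ξ_j - x_j ξ_i`, as a function of `‖ξ‖`. -/
noncomputable def momentFactor (u : ℝ → ℝ) (r : ℝ) : ℝ :=
  -2 * deriv u (Real.cosh (2 * r)) * (Real.cosh r * (Real.sinh r / r))

theorem momentMap_eq_momentFactor {n : ℕ} (u : ℝ → ℝ) {p : RSpace n × RSpace n} (hp : ‖p.1‖ = 1)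
    (i j : Fin (n + 1)) :
    momentMap u p (rotationGenerator i j) =
      momentFactor u ‖p.2‖ * (p.1 i * p.2 j - p.1 j * p.2 i) := by
  rw [momentMap_rotationGenerator, normSq_toQuadric hp, momentFactor]
  simp only [re_toQuadric, im_toQuadric]
  ring

theorem momentFactor_ne_zero {n : ℕ} {c : ℝ} {u : ℝ → ℝ} (hu : IsStenzelPotential n c u)
    (hc : 0 < c) (hn : n ≠ 0) {r : ℝ} (hr : 0 < r) : momentFactor u r ≠ 0 := by
  have h1 := (hu.monge_ampere hc hn (t := 2 * r) (by positivity)).1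
  have h2 := Real.sinh_pos_iff.2 hr
  have h3 := Real.cosh_pos r
  exact mul_ne_zero (mul_ne_zero (by norm_num) h1.ne') (by positivity)

theorem contDiffAt_momentFactor {n : ℕ} {c : ℝ} {u : ℝ → ℝ} (hu : IsStenzelPotential n c u)
    {r : ℝ} (hr : r ≠ 0) : ContDiffAt ℝ ∞ (momentFactor u) r := by
  have h1 : ContDiffAt ℝ ∞ (fun s => Real.cosh (2 * s)) r :=
    (Real.contDiff_cosh.comp (contDiff_const.mul contDiff_id)).contDiffAt
  have h2 : ContDiffAt ℝ ∞ (fun s => deriv u (Real.cosh (2 * s))) r :=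
    ContDiffAt.comp (g := deriv u) r (contDiffAt_deriv (hu.smooth _ (Real.one_le_cosh _))) h1
  exact (contDiffAt_const.mul h2).mul
    (Real.contDiff_cosh.contDiffAt.mul (Real.contDiff_sinh.contDiffAt.div contDiffAt_id hr))

theorem mem_fullLevel_iff {u : ℝ → ℝ} {p : RSpace 6 × RSpace 6} (hp : p ∈ subbundleL)
    (c₁ c₂ : ℝ) : p ∈ momentLevel u c₁ c₂ ↔
      momentFactor u ‖p.2‖ * (p.1 0 * p.2 1) = c₁ ∧ momentFactor u ‖p.2‖ * (p.1 2 * p.2 3) = c₂ := by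
  have h1 : p ∈ cotangentSphere 6 := by
    refine ⟨hp.1.1, ?_⟩
    obtain ⟨⟨-, h1, h3, h5, h6, k0, k2, k4⟩, k5, k6⟩ := hp
    rw [inner_eq_sum, Fin.sum_univ_seven]
    simp [h1, h3, h5, h6, k0, k2, k4]
  rw [momentLevel, Set.mem_sep_iff]
  simp only [momentMap_eq_momentFactor u hp.1.1]
  obtain ⟨⟨-, h1, h3, h5, h6, k0, k2, k4⟩, k5, k6⟩ := hp
  simp [*]

/-- For ξ ≠ 0 the factor is nonzero, so x₁ξ₂ = 0 and x₃ξ₄ = 0. Of the four cases, ξ₂ = ξ₄ = 0 would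
give ξ = 0, and x₁ = x₃ = 0 forces x₅ = ±1. -/
theorem fullLevel_zero {c : ℝ} {u : ℝ → ℝ} (hu : IsStenzelPotential 6 c u) (hc : 0 < c) :
    fullLevel u 0 0 = pieceSphere ∪ pieceCylinderOne ∪ pieceCylinderThree ∪ piecePlane 1 ∪
      piecePlane (-1) := by
  ext p
  constructor
  · rintro ⟨hp, hμ⟩
    rw [mem_fullLevel_iff hp] at hμ
    have hsum := sum_sq_of_mem_subbundleL hp
    simp only [Set.mem_union]
    rcases eq_or_ne p.2 0 with h0 | h0
    · exact Or.inl (Or.inl (Or.inl (Or.inl ⟨hp, h0⟩)))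
    have hm := momentFactor_ne_zero hu hc (by norm_num) (norm_pos_iff.2 h0)
    have h1 := (mul_eq_zero.1 ((mul_eq_zero_iff_left hm).1 hμ.1))
    have h2 := (mul_eq_zero.1 ((mul_eq_zero_iff_left hm).1 hμ.2))
    rcases h1 with h1 | h1 <;> rcases h2 with h2 | h2
    · have h3 : p.1 4 ^ 2 = 1 := by simpa [h1, h2] using hsum
      rcases eq_or_eq_neg_of_sq_eq_sq _ 1 (h3.trans (one_pow 2).symm) with h4 | h4
      · exact Or.inl (Or.inr ⟨hp, h1, h2, h4⟩)
      · exact Or.inr ⟨hp, h1, h2, h4⟩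
    · exact Or.inl (Or.inl (Or.inl (Or.inr ⟨hp, h1, h2⟩)))
    · exact Or.inl (Or.inl (Or.inr ⟨hp, h2, h1⟩))
    · refine absurd (PiLp.ext fun i => ?_) h0
      obtain ⟨⟨-, -, -, -, -, k0, k2, k4⟩, k5, k6⟩ := hp
      fin_cases i <;> simp [*]
  · intro h
    have hp : p ∈ subbundleL := by
      rcases h with (((h | h) | h) | h) | h <;> exact h.1
    refine ⟨hp, (mem_fullLevel_iff hp 0 0).2 ?_⟩
    rcases h with (((h | h) | h) | h) | h
    · simp [h.2]
    · simp [h.2.1, h.2.2]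
    · simp [h.2.1, h.2.2]
    · simp [h.2.1, h.2.2.1]
    · simp [h.2.1, h.2.2.1]

theorem sweep_union (S T : Set (RSpace 6 × RSpace 6)) : sweep (S ∪ T) = sweep S ∪ sweep T := by
  ext q
  constructor
  · rintro ⟨A, hA, p, hp | hp, rfl⟩
    · exact Or.inl ⟨A, hA, p, hp, rfl⟩
    · exact Or.inr ⟨A, hA, p, hp, rfl⟩
  · rintro (⟨A, hA, p, hp, rfl⟩ | ⟨A, hA, p, hp, rfl⟩)
    · exact ⟨A, hA, p, Or.inl hp, rfl⟩
    · exact ⟨A, hA, p, Or.inr hp, rfl⟩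

theorem groupH_noncommutative : ∃ A ∈ groupH, ∃ B ∈ groupH, A * B ≠ B * A := by
  have r0 := rotation_mem (c := 1) (s := 0) (by norm_num)
  have t1 := spherical_rotation_mem (a := 0) (b := 1) (c := 1) (s := 0) (by norm_num) (by norm_num)
  have t2 := spherical_rotation_mem (a := 1) (b := 0) (c := 0) (s := 1) (by norm_num) (by norm_num)
  refine ⟨_, ⟨_, r0, _, r0, _, t1, rfl⟩, _, ⟨_, r0, _, r0, _, t2, rfl⟩, fun h => ?_⟩
  -- Quarter turns about two different axes of the last block disagree in this entry of the two
  -- products.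
  have h1 := congrFun (congrFun h 4) 5
  simp [blockMatrix, Matrix.mul_apply, Fin.sum_univ_succ] at h1

/-! ### Nonzero levels: equations and submanifold property. -/

/-- The open set of points whose components in the three blocks of `H` are nondegenerate. -/
def regularSet : Set (RSpace 6 × RSpace 6) :=
  {p | p.2 ≠ 0 ∧ p.1 0 ^ 2 + p.1 1 ^ 2 + p.2 0 ^ 2 + p.2 1 ^ 2 ≠ 0 ∧
    p.1 2 ^ 2 + p.1 3 ^ 2 + p.2 2 ^ 2 + p.2 3 ^ 2 ≠ 0 ∧
    p.1 4 ^ 2 + p.1 5 ^ 2 + p.1 6 ^ 2 ≠ 0}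

theorem isOpen_regularSet : IsOpen regularSet := by
  refine IsOpen.inter (isOpen_ne_fun continuous_snd continuous_const) (IsOpen.inter
    (isOpen_ne_fun (by fun_prop) continuous_const) (IsOpen.inter
    (isOpen_ne_fun (by fun_prop) continuous_const)
    (isOpen_ne_fun (by fun_prop) continuous_const)))

/-- The equations cutting out the `H`-orbits of a level of the moment map. -/
noncomputable def levelMap (u : ℝ → ℝ) (c₁ c₂ : ℝ) (p : RSpace 6 × RSpace 6) :
    (ℝ × ℝ) × (ℝ × ℝ) × (ℝ × (ℝ × ℝ × ℝ)) :=
  ((p.1 0 * p.2 0 + p.1 1 * p.2 1,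
      momentFactor u ‖p.2‖ * (p.1 0 * p.2 1 - p.1 1 * p.2 0) - c₁),
    (p.1 2 * p.2 2 + p.1 3 * p.2 3,
      momentFactor u ‖p.2‖ * (p.1 2 * p.2 3 - p.1 3 * p.2 2) - c₂),
    (‖p.1‖ ^ 2 - 1, (p.2 4, p.2 5, p.2 6)))

theorem levelMap_eq_zero_iff {u : ℝ → ℝ} {c₁ c₂ : ℝ} {p : RSpace 6 × RSpace 6} :
    levelMap u c₁ c₂ p = 0 ↔ (p.1 0 * p.2 0 + p.1 1 * p.2 1 = 0 ∧
      momentFactor u ‖p.2‖ * (p.1 0 * p.2 1 - p.1 1 * p.2 0) = c₁) ∧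
      (p.1 2 * p.2 2 + p.1 3 * p.2 3 = 0 ∧
      momentFactor u ‖p.2‖ * (p.1 2 * p.2 3 - p.1 3 * p.2 2) = c₂) ∧
      ‖p.1‖ = 1 ∧ p.2 4 = 0 ∧ p.2 5 = 0 ∧ p.2 6 = 0 := by
  simp only [levelMap, Prod.mk_eq_zero, sub_eq_zero, pow_eq_one_iff_of_nonneg (norm_nonneg _)
    two_ne_zero]

theorem norm_orbitPoint_snd {a b e p q c₁ s₁ c₂ s₂ w₀ w₁ w₂ : ℝ} (h₁ : c₁ ^ 2 + s₁ ^ 2 = 1)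
    (h₂ : c₂ ^ 2 + s₂ ^ 2 = 1) :
    ‖(orbitPoint a b e p q c₁ s₁ c₂ s₂ w₀ w₁ w₂).2‖ = ‖(slicePoint a b e p q).2‖ := by
  rw [← sq_eq_sq₀ (norm_nonneg _) (norm_nonneg _), EuclideanSpace.real_norm_sq_eq,
    EuclideanSpace.real_norm_sq_eq, Fin.sum_univ_seven, Fin.sum_univ_seven]
  simp [orbitPoint, slicePoint]
  linear_combination p ^ 2 * h₁ + q ^ 2 * h₂

theorem snd_ne_zero_of_momentLevel {u : ℝ → ℝ} {c₁ c₂ : ℝ} (hc : (c₁, c₂) ≠ (0, 0))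
    {p : RSpace 6 × RSpace 6} (h₁ : momentFactor u ‖p.2‖ * (p.1 0 * p.2 1 - p.1 1 * p.2 0) = c₁)
    (h₂ : momentFactor u ‖p.2‖ * (p.1 2 * p.2 3 - p.1 3 * p.2 2) = c₂) : p.2 ≠ 0 := by
  intro h
  apply hc
  rw [← h₁, ← h₂, h]
  simp

/-- All equations and the nondegeneracy conditions are H-invariant, so they can be checked on the
slice, where nondegeneracy of the blocks is principality. The extra condition ξ ≠ 0 in `regularSet`
is automatic because (c₁, c₂) ≠ (0, 0). -/
theorem sweep_principalLevel {u : ℝ → ℝ} {c₁ c₂ : ℝ} (hc : (c₁, c₂) ≠ (0, 0)) :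
    sweep (principalLevel u c₁ c₂) = {p ∈ regularSet | levelMap u c₁ c₂ p = 0} := by
  ext x
  rw [mem_sweep_iff (S := principalLevel u c₁ c₂) fun y hy => hy.1.1, Set.mem_sep_iff,
    levelMap_eq_zero_iff]
  have key {a b e p q k₁ s₁ k₂ s₂ w₀ w₁ w₂ : ℝ} (h : a ^ 2 + b ^ 2 + e ^ 2 = 1)
      (h1 : k₁ ^ 2 + s₁ ^ 2 = 1) (h2 : k₂ ^ 2 + s₂ ^ 2 = 1) (h3 : w₀ ^ 2 + w₁ ^ 2 + w₂ ^ 2 = 1) :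
      slicePoint a b e p q ∈ principalLevel u c₁ c₂ ↔
        (a ^ 2 + p ^ 2 ≠ 0 ∧ b ^ 2 + q ^ 2 ≠ 0 ∧ e ^ 2 ≠ 0) ∧
        momentFactor u ‖(orbitPoint a b e p q k₁ s₁ k₂ s₂ w₀ w₁ w₂).2‖ * (a * p) = c₁ ∧
        momentFactor u ‖(orbitPoint a b e p q k₁ s₁ k₂ s₂ w₀ w₁ w₂).2‖ * (b * q) = c₂ := by
    have hne (x y : ℝ) : x ^ 2 + y ^ 2 ≠ 0 ↔ x ≠ 0 ∨ y ≠ 0 := by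
      rw [Ne, add_eq_zero_iff_of_nonneg (sq_nonneg _) (sq_nonneg _), sq_eq_zero_iff,
        sq_eq_zero_iff, not_and_or]
    rw [principalLevel, Set.mem_inter_iff, slicePoint_mem_principalL_iff h,
      mem_fullLevel_iff (slicePoint_mem h _ _), norm_orbitPoint_snd h1 h2, hne, hne,
      pow_ne_zero_iff two_ne_zero]
    simp [slicePoint]
  constructor
  · rintro ⟨a, b, e, p, q, k₁, s₁, k₂, s₂, w₀, w₁, w₂, hS, h1, h2, h3, rfl⟩
    have h := slicePoint_mem_iff.1 hS.1.1
    obtain ⟨⟨r1, r2, r3⟩, m1, m2⟩ := (key h h1 h2 h3).1 hS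
    have m1' : momentFactor u ‖(orbitPoint a b e p q k₁ s₁ k₂ s₂ w₀ w₁ w₂).2‖ *
        (a * k₁ * (p * k₁) - a * s₁ * -(p * s₁)) = c₁ := by
      rw [← m1]
      linear_combination momentFactor u ‖(orbitPoint a b e p q k₁ s₁ k₂ s₂ w₀ w₁ w₂).2‖ * a * p * h1
    have m2' : momentFactor u ‖(orbitPoint a b e p q k₁ s₁ k₂ s₂ w₀ w₁ w₂).2‖ *
        (b * k₂ * (q * k₂) - b * s₂ * -(q * s₂)) = c₂ := by
      rw [← m2]
      linear_combination momentFactor u ‖(orbitPoint a b e p q k₁ s₁ k₂ s₂ w₀ w₁ w₂).2‖ * b * q * h2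
    refine ⟨⟨snd_ne_zero_of_momentLevel hc m1' m2', ?_, ?_, ?_⟩, ⟨?_, m1'⟩, ⟨?_, m2'⟩,
      norm_orbitPoint_fst _ _ h h1 h2 h3, rfl, rfl, rfl⟩
    · intro h0
      apply r1
      simp [orbitPoint] at h0
      linear_combination h0 - (a ^ 2 + p ^ 2) * h1
    · intro h0
      apply r2
      simp [orbitPoint] at h0
      linear_combination h0 - (b ^ 2 + q ^ 2) * h2
    · intro h0
      apply r3
      simp [orbitPoint] at h0
      linear_combination h0 - e ^ 2 * h3
    · simp [orbitPoint]
      ring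
    · simp [orbitPoint]
      ring
  · rintro ⟨⟨-, r1, r2, r3⟩, ⟨h1, m1⟩, ⟨h2, m2⟩, h0, h4, h5, h6⟩
    obtain ⟨a, b, e, p, q, k₁, s₁, k₂, s₂, w₀, w₁, w₂, h, hk₁, hk₂, hw, rfl⟩ :=
      exists_eq_orbitPoint h0 h1 h2 h4 h5 h6
    refine ⟨a, b, e, p, q, k₁, s₁, k₂, s₂, w₀, w₁, w₂,
      (key h hk₁ hk₂ hw).2 ⟨⟨?_, ?_, ?_⟩, ?_, ?_⟩, hk₁, hk₂, hw, rfl⟩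
    · intro h'
      apply r1
      simp [orbitPoint]
      linear_combination h' + (a ^ 2 + p ^ 2) * hk₁
    · intro h'
      apply r2
      simp [orbitPoint]
      linear_combination h' + (b ^ 2 + q ^ 2) * hk₂
    · intro h'
      apply r3
      simp [orbitPoint]
      linear_combination h' + e ^ 2 * hw
    · rw [← m1]
      congr 1
      simp [orbitPoint]
      linear_combination -a * p * hk₁
    · rw [← m2]
      congr 1
      simp [orbitPoint]
      linear_combination -b * q * hk₂

/-- Solves the linearized equations of one plane block. The number d is the derivative of the moment
factor; it depends on the ξ-variations of all blocks at once, hence the order of the quantifiers: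
the variation b of ξ is fixed before d is known. If ξ vanishes in the block, d has coefficient 0 and
b alone suffices; otherwise b = 0 and the variation a of x does the work. -/
theorem exists_block_preimage {x₀ x₁ ξ₀ ξ₁ m : ℝ} (hm : m ≠ 0)
    (h : x₀ ^ 2 + x₁ ^ 2 + ξ₀ ^ 2 + ξ₁ ^ 2 ≠ 0) (s t : ℝ) :
    ∃ b₀ b₁ : ℝ, ∀ d : ℝ, ∃ a₀ a₁ : ℝ, x₀ * b₀ + ξ₀ * a₀ + (x₁ * b₁ + ξ₁ * a₁) = s ∧
      m * (x₀ * b₁ + ξ₁ * a₀ - (x₁ * b₀ + ξ₀ * a₁)) + (x₀ * ξ₁ - x₁ * ξ₀) * d = t := by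
  rcases eq_or_ne (ξ₀ ^ 2 + ξ₁ ^ 2) 0 with h0 | h0
  · have hξ₀ : ξ₀ = 0 := by nlinarith [sq_nonneg ξ₀, sq_nonneg ξ₁]
    have hξ₁ : ξ₁ = 0 := by nlinarith [sq_nonneg ξ₀, sq_nonneg ξ₁]
    subst hξ₀ hξ₁
    have h1 : x₀ ^ 2 + x₁ ^ 2 ≠ 0 := by simpa using h
    refine ⟨(s * x₀ - t / m * x₁) / (x₀ ^ 2 + x₁ ^ 2), (s * x₁ + t / m * x₀) / (x₀ ^ 2 + x₁ ^ 2),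
      fun d => ⟨0, 0, ?_, ?_⟩⟩
    · field_simp
      ring
    · field_simp
      ring
  · refine ⟨0, 0, fun d => ?_⟩
    obtain ⟨t', ht⟩ : ∃ t', t' = (t - (x₀ * ξ₁ - x₁ * ξ₀) * d) / m := ⟨_, rfl⟩
    have ht' : m * t' + (x₀ * ξ₁ - x₁ * ξ₀) * d = t := by
      rw [ht]
      field_simp
      ring
    refine ⟨(s * ξ₀ + t' * ξ₁) / (ξ₀ ^ 2 + ξ₁ ^ 2), (s * ξ₁ - t' * ξ₀) / (ξ₀ ^ 2 + ξ₁ ^ 2), ?_, ?_⟩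
    · field_simp
      ring
    · rw [← ht']
      congr 2
      field_simp
      ring

theorem contDiffOn_levelMap {n : ℕ} {c : ℝ} {u : ℝ → ℝ} (hu : IsStenzelPotential n c u)
    (c₁ c₂ : ℝ) : ContDiffOn ℝ ∞ (levelMap u c₁ c₂) regularSet := by
  intro p hp
  refine ContDiffAt.contDiffWithinAt ?_
  have hm : ContDiffAt ℝ ∞ (fun q : RSpace 6 × RSpace 6 => momentFactor u ‖q.2‖) p :=
    ContDiffAt.comp (g := momentFactor u) p (contDiffAt_momentFactor hu (norm_ne_zero_iff.2 hp.1))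
      ((contDiffAt_norm ℝ hp.1).comp p contDiffAt_snd)
  refine ContDiffAt.prodMk (ContDiffAt.prodMk (by fun_prop) ?_) (ContDiffAt.prodMk
    (ContDiffAt.prodMk (by fun_prop) ?_) (ContDiffAt.prodMk
      ((contDiff_fst.norm_sq ℝ).sub contDiff_const).contDiffAt (by fun_prop)))
  · exact (hm.mul (by fun_prop)).sub contDiffAt_const
  · exact (hm.mul (by fun_prop)).sub contDiffAt_const

theorem surjective_fderiv_levelMap {c : ℝ} {u : ℝ → ℝ} (hu : IsStenzelPotential 6 c u)
    (hc : 0 < c) {c₁ c₂ : ℝ} {p : RSpace 6 × RSpace 6} (hp : p ∈ regularSet) :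
    Function.Surjective (fderiv ℝ (levelMap u c₁ c₂) p) := by
  let e (i : Fin 7) : RSpace 6 →L[ℝ] ℝ := EuclideanSpace.proj i
  have hx (i : Fin 7) : HasFDerivAt (fun q : RSpace 6 × RSpace 6 => q.1 i)
      ((e i).comp (ContinuousLinearMap.fst ℝ (RSpace 6) (RSpace 6))) p :=
    ((e i).comp (ContinuousLinearMap.fst ℝ (RSpace 6) (RSpace 6))).hasFDerivAt
  have hy (i : Fin 7) : HasFDerivAt (fun q : RSpace 6 × RSpace 6 => q.2 i)
      ((e i).comp (ContinuousLinearMap.snd ℝ (RSpace 6) (RSpace 6))) p :=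
    ((e i).comp (ContinuousLinearMap.snd ℝ (RSpace 6) (RSpace 6))).hasFDerivAt
  obtain ⟨κ, hκ⟩ : ∃ κ : RSpace 6 →L[ℝ] ℝ, HasFDerivAt (fun ξ => momentFactor u ‖ξ‖) κ p.2 :=
    ⟨_, (DifferentiableAt.comp (g := momentFactor u) p.2
      ((contDiffAt_momentFactor hu (norm_ne_zero_iff.2 hp.1)).differentiableAt (by simp))
      ((contDiffAt_norm ℝ hp.1 (n := 1)).differentiableAt one_ne_zero)).hasFDerivAt⟩
  have hm : HasFDerivAt (fun q : RSpace 6 × RSpace 6 => momentFactor u ‖q.2‖)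
      (κ.comp (ContinuousLinearMap.snd ℝ (RSpace 6) (RSpace 6))) p :=
    HasFDerivAt.comp p hκ hasFDerivAt_snd
  have hn : HasFDerivAt (fun q : RSpace 6 × RSpace 6 => ‖q.1‖ ^ 2 - 1)
      ((2 • innerSL ℝ p.1).comp (ContinuousLinearMap.fst ℝ (RSpace 6) (RSpace 6))) p :=
    ((hasStrictFDerivAt_norm_sq p.1).hasFDerivAt.comp p hasFDerivAt_fst).sub_const 1
  have hperp (i j : Fin 7) := ((hx i).fun_mul (hy i)).fun_add ((hx j).fun_mul (hy j))
  have hmom (i j : Fin 7) (b : ℝ) :=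
    (hm.fun_mul (((hx i).fun_mul (hy j)).fun_sub ((hx j).fun_mul (hy i)))).sub_const b
  rw [show fderiv ℝ (levelMap u c₁ c₂) p = _ from
    (((hperp 0 1).prodMk (hmom 0 1 c₁)).prodMk (((hperp 2 3).prodMk (hmom 2 3 c₂)).prodMk
      (hn.prodMk ((hy 4).prodMk ((hy 5).prodMk (hy 6)))))).fderiv]
  rintro ⟨⟨s₁, t₁⟩, ⟨s₂, t₂⟩, τ, y₄, y₅, y₆⟩
  have hm0 := momentFactor_ne_zero hu hc (by norm_num) (norm_pos_iff.2 hp.1)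
  obtain ⟨b₀, b₁, hb⟩ := exists_block_preimage hm0 hp.2.1 s₁ t₁
  obtain ⟨b₂, b₃, hb'⟩ := exists_block_preimage hm0 hp.2.2.1 s₂ t₂
  set b : RSpace 6 := !₂[b₀, b₁, b₂, b₃, y₄, y₅, y₆] with hbdef
  obtain ⟨a₀, a₁, h1, h2⟩ := hb (κ b)
  obtain ⟨a₂, a₃, h3, h4⟩ := hb' (κ b)
  -- The remaining equation, for ‖x‖², is met by rescaling the last block of x, which is nonzero on
  -- `regularSet`.
  obtain ⟨l, hl⟩ : ∃ l : ℝ, p.1 0 * a₀ + p.1 1 * a₁ + p.1 2 * a₂ + p.1 3 * a₃ +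
      l * (p.1 4 ^ 2 + p.1 5 ^ 2 + p.1 6 ^ 2) = τ / 2 := by
    refine ⟨(τ / 2 - (p.1 0 * a₀ + p.1 1 * a₁ + p.1 2 * a₂ + p.1 3 * a₃)) /
      (p.1 4 ^ 2 + p.1 5 ^ 2 + p.1 6 ^ 2), ?_⟩
    rw [div_mul_cancel₀ _ hp.2.2.2]
    ring
  set a : RSpace 6 := !₂[a₀, a₁, a₂, a₃, l * p.1 4, l * p.1 5, l * p.1 6] with hadef
  have hin : inner ℝ p.1 a = τ / 2 := by
    rw [inner_eq_sum, Fin.sum_univ_seven, ← hl]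
    simp [hadef]
    ring
  refine ⟨(a, b), ?_⟩
  have e0 : e 0 a = a₀ := rfl
  have e1 : e 1 a = a₁ := rfl
  have e2 : e 2 a = a₂ := rfl
  have e3 : e 3 a = a₃ := rfl
  have f0 : e 0 b = b₀ := rfl
  have f1 : e 1 b = b₁ := rfl
  have f2 : e 2 b = b₂ := rfl
  have f3 : e 3 b = b₃ := rfl
  have f4 : e 4 b = y₄ := rfl
  have f5 : e 5 b = y₅ := rfl
  have f6 : e 6 b = y₆ := rfl
  simp only [ContinuousLinearMap.prod_apply, add_apply, sub_apply, smul_apply, smul_eq_mul,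
    ContinuousLinearMap.comp_apply, ContinuousLinearMap.coe_fst', ContinuousLinearMap.coe_snd',
    e0, e1, e2, e3, f0, f1, f2, f3, f4, f5, f6, h1, h2, h3, h4, innerSL_apply_apply, hin]
  simp
  ring

theorem isSubmanifold_sweep_principalLevel {c : ℝ} {u : ℝ → ℝ} (hu : IsStenzelPotential 6 c u)
    (hc : 0 < c) {c₁ c₂ : ℝ} (h : (c₁, c₂) ≠ (0, 0)) :
    IsSubmanifold 6 (sweep (principalLevel u c₁ c₂)) := by
  rw [sweep_principalLevel h]
  refine isSubmanifold_of_surjective_fderiv (F := (ℝ × ℝ) × (ℝ × ℝ) × (ℝ × (ℝ × ℝ × ℝ)))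
    (by simp) fun p hp => ?_
  refine ⟨regularSet, levelMap u c₁ c₂, isOpen_regularSet, hp.1, contDiffOn_levelMap hu c₁ c₂,
    surjective_fderiv_levelMap hu hc hp.1, Set.inter_eq_left.2 fun q hq => hq.1⟩

/-! ### Nonzero levels: the Kähler form vanishes. -/

theorem real_inner_eq_sum {n : ℕ} (z w : CSpace n) :
    inner ℝ z w = ∑ i, ((z i).re * (w i).re + (z i).im * (w i).im) := by
  rw [PiLp.inner_apply]
  refine Finset.sum_congr rfl fun i _ => ?_
  rw [Complex.inner]
  simp
  ring

/-- The linearized equations of `Φ(H · V)` at `z` for a tangent vector `v`: the blocks `(z_1, z_2)`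
and `(z_3, z_4)` have orthogonal real and imaginary parts, the last block is real, and
`u'(r²) Im (z_2 conj z_1)` and `u'(r²) Im (z_4 conj z_3)` are constant. Here `a` and `b` are the values
of `u'` and `u''` at `r²`. -/
structure IsLevelTangent (a b : ℝ) (z v : CSpace 6) : Prop where
  perp₁ : (z 0).re * (v 0).im + (z 0).im * (v 0).re +
    ((z 1).re * (v 1).im + (z 1).im * (v 1).re) = 0
  perp₂ : (z 2).re * (v 2).im + (z 2).im * (v 2).re +
    ((z 3).re * (v 3).im + (z 3).im * (v 3).re) = 0
  moment₁ : a * ((z 1).im * (v 0).re + (z 0).re * (v 1).im -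
    ((z 1).re * (v 0).im + (z 0).im * (v 1).re)) +
    ((z 1).im * (z 0).re - (z 1).re * (z 0).im) * (b * (2 * inner ℝ z v)) = 0
  moment₂ : a * ((z 3).im * (v 2).re + (z 2).re * (v 3).im -
    ((z 3).re * (v 2).im + (z 2).im * (v 3).re)) +
    ((z 3).im * (z 2).re - (z 3).re * (z 2).im) * (b * (2 * inner ℝ z v)) = 0
  im₄ : (v 4).im = 0
  im₅ : (v 5).im = 0
  im₆ : (v 6).im = 0

/-- The imaginary part of the identity |z|²⟨v, w⟩ = (z·v) conj(z·w) + δ(v) conj(δ(w)) in ℂ², where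
δ(v) = conj(z₀) v₁ - conj(z₁) v₀. The hypotheses say that z·v and z·w are real, so only the second
product contributes. -/
theorem block_im_identity {x₀ y₀ x₁ y₁ a₀ b₀ a₁ b₁ a₀' b₀' a₁' b₁' : ℝ}
    (h : x₀ * b₀ + y₀ * a₀ + (x₁ * b₁ + y₁ * a₁) = 0)
    (h' : x₀ * b₀' + y₀ * a₀' + (x₁ * b₁' + y₁ * a₁') = 0) :
    (x₀ ^ 2 + x₁ ^ 2 + y₀ ^ 2 + y₁ ^ 2) * (b₀ * a₀' - a₀ * b₀' + (b₁ * a₁' - a₁ * b₁')) =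
      (y₁ * a₀ + x₀ * b₁ - (x₁ * b₀ + y₀ * a₁)) * (x₀ * a₁' + y₀ * b₁' - (x₁ * a₀' + y₁ * b₀')) -
      (x₀ * a₁ + y₀ * b₁ - (x₁ * a₀ + y₁ * b₀)) * (y₁ * a₀' + x₀ * b₁' - (x₁ * b₀' + y₀ * a₁')) := by
  linear_combination (x₀ * a₀' - y₀ * b₀' + x₁ * a₁' - y₁ * b₁') * h -
    (x₀ * a₀ - y₀ * b₀ + x₁ * a₁ - y₁ * b₁) * h'

/-- The contribution of one block to the Kähler form vanishes; `s` and `s'` are half the derivatives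
of `r²` along the two vectors. -/
theorem block_kahler_eq_zero {a b s s' x₀ y₀ x₁ y₁ a₀ b₀ a₁ b₁ a₀' b₀' a₁' b₁' : ℝ}
    (hP : x₀ ^ 2 + x₁ ^ 2 + y₀ ^ 2 + y₁ ^ 2 ≠ 0) (hz : x₀ * y₀ + x₁ * y₁ = 0)
    (h : x₀ * b₀ + y₀ * a₀ + (x₁ * b₁ + y₁ * a₁) = 0)
    (h' : x₀ * b₀' + y₀ * a₀' + (x₁ * b₁' + y₁ * a₁') = 0)
    (hm : a * (y₁ * a₀ + x₀ * b₁ - (x₁ * b₀ + y₀ * a₁)) + (y₁ * x₀ - x₁ * y₀) * (b * (2 * s)) = 0)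
    (hm' : a * (y₁ * a₀' + x₀ * b₁' - (x₁ * b₀' + y₀ * a₁')) +
      (y₁ * x₀ - x₁ * y₀) * (b * (2 * s')) = 0) :
    a * (b₀ * a₀' - a₀ * b₀' + (b₁ * a₁' - a₁ * b₁')) +
      b * ((b₀ * x₀ - a₀ * y₀ + (b₁ * x₁ - a₁ * y₁)) * s' -
        s * (b₀' * x₀ - a₀' * y₀ + (b₁' * x₁ - a₁' * y₁))) = 0 := by
  have hzz : x₀ * y₀ + y₀ * x₀ + (x₁ * y₁ + y₁ * x₁) = 0 := by linear_combination 2 * hz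
  have k1 := block_im_identity h h'
  -- The same identity with z as second vector computes Im⟨v, z⟩. After multiplication by the
  -- squared norm of the block, the linearized moment equations cancel everything.
  have k2 := block_im_identity h hzz
  have k3 := block_im_identity h' hzz
  apply mul_left_cancel₀ hP
  linear_combination a * k1 + b * s' * k2 - b * s * k3 +
    (x₀ * a₁' + y₀ * b₁' - (x₁ * a₀' + y₁ * b₀')) * hm -
    (x₀ * a₁ + y₀ * b₁ - (x₁ * a₀ + y₁ * b₀)) * hm'

/-- A point of `Φ(H · V)`. -/
structure IsLevelPoint (z : CSpace 6) : Prop where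
  perp₁ : (z 0).re * (z 0).im + (z 1).re * (z 1).im = 0
  perp₂ : (z 2).re * (z 2).im + (z 3).re * (z 3).im = 0
  ne₁ : (z 0).re ^ 2 + (z 1).re ^ 2 + (z 0).im ^ 2 + (z 1).im ^ 2 ≠ 0
  ne₂ : (z 2).re ^ 2 + (z 3).re ^ 2 + (z 2).im ^ 2 + (z 3).im ^ 2 ≠ 0
  im₄ : (z 4).im = 0
  im₅ : (z 5).im = 0
  im₆ : (z 6).im = 0

theorem im_sum_mul_conj (v w : CSpace 6) :
    (∑ i, v i * (starRingEnd ℂ) (w i)).im =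
      ∑ i, ((v i).im * (w i).re - (v i).re * (w i).im) := by
  rw [Complex.im_sum]
  refine Finset.sum_congr rfl fun i _ => ?_
  simp
  ring

theorem re_sum_mul_conj (v w : CSpace 6) :
    (∑ i, v i * (starRingEnd ℂ) (w i)).re = inner ℝ v w := by
  rw [Complex.re_sum, real_inner_eq_sum]
  refine Finset.sum_congr rfl fun i _ => ?_
  simp

theorem im_kahlerPairing_eq_zero {u : ℝ → ℝ} {z v w : CSpace 6} (hz : IsLevelPoint z)
    (hv : IsLevelTangent (deriv u (‖z‖ ^ 2)) (deriv (deriv u) (‖z‖ ^ 2)) z v)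
    (hw : IsLevelTangent (deriv u (‖z‖ ^ 2)) (deriv (deriv u) (‖z‖ ^ 2)) z w) :
    (kahlerPairing u z v w).im = 0 := by
  have k1 := block_kahler_eq_zero hz.ne₁ hz.perp₁ hv.perp₁ hw.perp₁ hv.moment₁ hw.moment₁
  have k2 := block_kahler_eq_zero hz.ne₂ hz.perp₂ hv.perp₂ hw.perp₂ hv.moment₂ hw.moment₂
  rw [kahlerPairing, Complex.add_im, Complex.im_ofReal_mul, Complex.im_ofReal_mul, Complex.mul_im,
    re_sum_mul_conj, re_sum_mul_conj, im_sum_mul_conj, im_sum_mul_conj, im_sum_mul_conj,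
    Fin.sum_univ_seven, Fin.sum_univ_seven, Fin.sum_univ_seven, real_inner_comm z v,
    hz.im₄, hz.im₅, hz.im₆, hv.im₄, hv.im₅, hv.im₆, hw.im₄, hw.im₅, hw.im₆]
  linear_combination k1 + k2

/-! ### Nonzero levels: the phase is constant. -/

/-- Up to the factor a, this is the K-Gram determinant of the two rotation fields; P_i is the
squared norm of a block, p_i the real part of its complex square, and E the last block. For b ≥ 0
every term is nonnegative; for b < 0, R times the quantity is P₁P₂(R a + (R² - 1) b) plus -b times a
sum of squares. -/
theorem gram_pos {a b P₁ P₂ p₁ p₂ E R : ℝ} (ha : 0 < a) (hD : 0 < R * a + (R ^ 2 - 1) * b)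
    (hR : R = P₁ + P₂ + E) (h1 : p₁ + p₂ + E = 1) (hP₁ : 0 < P₁) (hP₂ : 0 < P₂) (hE : 0 ≤ E)
    (hp₁ : p₁ ^ 2 ≤ P₁ ^ 2) (hp₂ : p₂ ^ 2 ≤ P₂ ^ 2) :
    0 < a * (P₁ * P₂) + b * (P₁ * (P₂ ^ 2 - p₂ ^ 2) + P₂ * (P₁ ^ 2 - p₁ ^ 2)) := by
  have hPP := mul_pos hP₁ hP₂
  rcases le_or_gt 0 b with hb | hb
  · have : 0 ≤ P₁ * (P₂ ^ 2 - p₂ ^ 2) + P₂ * (P₁ ^ 2 - p₁ ^ 2) :=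
      add_nonneg (mul_nonneg hP₁.le (sub_nonneg.2 hp₂)) (mul_nonneg hP₂.le (sub_nonneg.2 hp₁))
    exact add_pos_of_pos_of_nonneg (mul_pos ha hPP) (mul_nonneg hb this)
  · have hRpos : 0 < R := by rw [hR]; linarith
    have key : 0 ≤ (R ^ 2 - 1) * (P₁ * P₂) -
        R * (P₁ * (P₂ ^ 2 - p₂ ^ 2) + P₂ * (P₁ ^ 2 - p₁ ^ 2)) := by
      have : (R ^ 2 - 1) * (P₁ * P₂) - R * (P₁ * (P₂ ^ 2 - p₂ ^ 2) + P₂ * (P₁ ^ 2 - p₁ ^ 2)) =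
          E * P₂ * (P₁ - p₁) ^ 2 + E * P₁ * (P₂ - p₂) ^ 2 + (p₁ * P₂ - p₂ * P₁) ^ 2 := by
        -- Homogenizing the 1 in R² - 1 by p₁ + p₂ + E = 1 turns the claim into a polynomial
        -- identity.
        have hsq : P₁ * P₂ = P₁ * P₂ * (p₁ + p₂ + E) ^ 2 := by rw [h1]; ring
        rw [sub_mul, one_mul]
        nth_rewrite 2 [hsq]
        rw [hR]
        ring
      rw [this]
      positivity
    have h2 : 0 < R * (a * (P₁ * P₂) + b * (P₁ * (P₂ ^ 2 - p₂ ^ 2) + P₂ * (P₁ ^ 2 - p₁ ^ 2))) := by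
      nlinarith [mul_pos hD hPP, mul_nonneg (neg_pos.2 hb).le key]
    exact pos_of_mul_pos_right h2 hRpos.le

section LevelTangent

open Matrix ComplexConjugate

theorem det_block_rows {R : Type*} [CommRing R] (x₀ x₁ x₂ x₃ : R) (r s : Fin 7 → R) :
    det (of ![Pi.single 4 1, Pi.single 5 1, Pi.single 6 1, ![x₀, x₁, 0, 0, 0, 0, 0], r,
      ![0, 0, x₂, x₃, 0, 0, 0], s]) =
      (x₀ * r 1 - x₁ * r 0) * (x₂ * s 3 - x₃ * s 2) -
        (x₀ * s 1 - x₁ * s 0) * (x₂ * r 3 - x₃ * r 2) := by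
  simp [Matrix.det_succ_row_zero, Fin.sum_univ_succ, Fin.succAbove, Pi.single_apply]
  ring

/-- M Qᵀ is a real matrix, so det M · det Q is real, and det Q is real and nonzero. -/
theorem im_det_eq_zero_of_real_pairings {N : ℕ} {M Q : Fin N → Fin N → ℂ} {g : ℝ} (hg : g ≠ 0)
    (hQ : det (of Q) = g) (h : ∀ i j, (M i ⬝ᵥ Q j).im = 0) : (det (of M)).im = 0 := by
  have h1 : of M * (of Q)ᵀ = Complex.ofRealHom.mapMatrix (of fun i j => (M i ⬝ᵥ Q j).re) := by
    ext i j
    exact Complex.ext rfl ((h i j).trans (by simp))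
  have h2 := congrArg det h1
  rw [det_mul, det_transpose, hQ, ← RingHom.map_det] at h2
  have h3 := congrArg Complex.im h2
  simpa [hg] using h3

/-- The covector `∑ ∂²u(r²)/∂z_i∂(conj z_j) dz_i conj X_j`, `X` the rotation field of the coordinates
`i, j`, corrected by a multiple of `z` so as to annihilate `z`. -/
noncomputable def rotationCovector (a b R : ℝ) (z : CSpace 6) (i j k : Fin 7) : ℂ :=
  a * ((Pi.single j (conj (z i)) : Fin 7 → ℂ) k - (Pi.single i (conj (z j)) : Fin 7 → ℂ) k) +
    (z j * conj (z i) - z i * conj (z j)) * (b * conj (z k) - (a + b * R) * z k)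

theorem dotProduct_rotationCovector (a b R : ℝ) (z : CSpace 6) (i j : Fin 7) (y : Fin 7 → ℂ) :
    y ⬝ᵥ rotationCovector a b R z i j = a * (y j * conj (z i) - y i * conj (z j)) +
      (z j * conj (z i) - z i * conj (z j)) *
        (b * ∑ k, y k * conj (z k) - (a + b * R) * ∑ k, z k * y k) := by
  have h1 (l : Fin 7) (x : ℂ) : ∑ k, y k * (Pi.single l x : Fin 7 → ℂ) k = y l * x :=
    dotProduct_single _ _ _
  have h2 : y ⬝ᵥ rotationCovector a b R z i j =
      a * (∑ k, y k * (Pi.single j (conj (z i)) : Fin 7 → ℂ) k -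
        ∑ k, y k * (Pi.single i (conj (z j)) : Fin 7 → ℂ) k) +
      (z j * conj (z i) - z i * conj (z j)) *
        (b * ∑ k, y k * conj (z k) - (a + b * R) * ∑ k, z k * y k) := by
    simp only [dotProduct, rotationCovector, Finset.mul_sum, ← Finset.sum_sub_distrib,
      ← Finset.sum_add_distrib]
    exact Finset.sum_congr rfl fun k _ => by ring
  rw [h2, h1, h1]

/-- `Im (z_j conj z_i)`. -/
def crossTerm (z : CSpace 6) (i j : Fin 7) : ℝ := (z j).im * (z i).re - (z j).re * (z i).im

/-- The value is K(X, X) for the rotation field X: |X|² is the squared norm of the block and |⟨X,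
z⟩| is twice the cross term. For two different blocks the analogous minor is the mixed pairing, in
which only the u'' term survives. -/
theorem rotationCovector_minor (a b R : ℝ) (z : CSpace 6) {i j : Fin 7} (hij : i ≠ j) :
    z i * rotationCovector a b R z i j j - z j * rotationCovector a b R z i j i =
      ((a * ((z i).re ^ 2 + (z j).re ^ 2 + (z i).im ^ 2 + (z j).im ^ 2) +
        b * (4 * crossTerm z i j ^ 2) : ℝ) : ℂ) := by
  apply Complex.ext
  · rw [Complex.ofReal_re]
    simp [rotationCovector, crossTerm, hij, hij.symm]
    ring
  · rw [Complex.ofReal_im]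
    simp [rotationCovector, hij, hij.symm]
    ring

theorem rotationCovector_minor_of_ne (a b R : ℝ) (z : CSpace 6) {i j k l : Fin 7} (hik : k ≠ i)
    (hil : l ≠ i) (hjk : k ≠ j) (hjl : l ≠ j) :
    z i * rotationCovector a b R z k l j - z j * rotationCovector a b R z k l i =
      ((4 * b * crossTerm z i j * crossTerm z k l : ℝ) : ℂ) := by
  apply Complex.ext
  · rw [Complex.ofReal_re]
    simp [rotationCovector, crossTerm, hik.symm, hil.symm, hjk.symm, hjl.symm]
    ring
  · rw [Complex.ofReal_im]
    simp [rotationCovector, hik.symm, hil.symm, hjk.symm, hjl.symm]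
    ring

theorem im_dotProduct_block_rows {x₀ x₁ x₂ x₃ : ℂ} {r s y : Fin 7 → ℂ} (h4 : (y 4).im = 0)
    (h5 : (y 5).im = 0) (h6 : (y 6).im = 0) (h01 : (y 0 * x₀ + y 1 * x₁).im = 0)
    (h23 : (y 2 * x₂ + y 3 * x₃).im = 0) (hr : (y ⬝ᵥ r).im = 0) (hs : (y ⬝ᵥ s).im = 0) (j : Fin 7) :
    (y ⬝ᵥ (![Pi.single 4 1, Pi.single 5 1, Pi.single 6 1, ![x₀, x₁, 0, 0, 0, 0, 0], r,
      ![0, 0, x₂, x₃, 0, 0, 0], s] : Fin 7 → Fin 7 → ℂ) j).im = 0 := by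
  have q01 : y ⬝ᵥ ![x₀, x₁, 0, 0, 0, 0, 0] = y 0 * x₀ + y 1 * x₁ := by
    simp [dotProduct, Fin.sum_univ_seven]
  have q23 : y ⬝ᵥ ![0, 0, x₂, x₃, 0, 0, 0] = y 2 * x₂ + y 3 * x₃ := by
    simp [dotProduct, Fin.sum_univ_seven]
  have e (i : Fin 7) : y ⬝ᵥ Pi.single i 1 = y i := by rw [dotProduct_single, mul_one]
  fin_cases j
  · exact (congrArg Complex.im (e 4)).trans h4
  · exact (congrArg Complex.im (e 5)).trans h5
  · exact (congrArg Complex.im (e 6)).trans h6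
  · exact (congrArg Complex.im q01).trans h01
  · exact hr
  · exact (congrArg Complex.im q23).trans h23
  · exact hs

/-- For z·v = 0 the correction term drops out, and Im K(v, X) = 0 is the linearized moment equation.
-/
theorem im_dotProduct_rotationCovector {a b R : ℝ} {z v : CSpace 6} {i j : Fin 7}
    (hzv : ∑ k, z k * v k = 0)
    (hm : a * ((z j).im * (v i).re + (z i).re * (v j).im -
      ((z j).re * (v i).im + (z i).im * (v j).re)) +
      ((z j).im * (z i).re - (z j).re * (z i).im) * (b * (2 * inner ℝ z v)) = 0) :
    ((v : Fin 7 → ℂ) ⬝ᵥ rotationCovector a b R z i j).im = 0 := by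
  have hin : (∑ k, v k * conj (z k)).re = inner ℝ z v := by
    rw [re_sum_mul_conj, real_inner_comm]
  rw [dotProduct_rotationCovector, hzv]
  simp only [Complex.add_im, Complex.sub_im, Complex.sub_re, Complex.mul_im, Complex.mul_re,
    Complex.conj_re, Complex.conj_im, Complex.ofReal_re, Complex.ofReal_im, Complex.zero_re,
    Complex.zero_im, hin]
  linear_combination hm

theorem im_det_eq_zero_of_isLevelTangent {u : ℝ → ℝ} {z : CSpace 6} (hz : IsLevelPoint z)
    (hzz : ∑ i, z i * z i = 1) {v : Fin 6 → CSpace 6} (hzv : ∀ k, ∑ i, z i * v k i = 0)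
    (ha : 0 < deriv u (‖z‖ ^ 2))
    (hD : 0 < ‖z‖ ^ 2 * deriv u (‖z‖ ^ 2) + ((‖z‖ ^ 2) ^ 2 - 1) * deriv (deriv u) (‖z‖ ^ 2))
    (hv : ∀ k, IsLevelTangent (deriv u (‖z‖ ^ 2)) (deriv (deriv u) (‖z‖ ^ 2)) z (v k)) :
    (det (of fun i j => (Fin.cons z v : Fin 7 → CSpace 6) i j)).im = 0 := by
  have hR := ofReal_normSq_eq_sum z
  have hRre := normSq_eq_sum_re_im z
  set a := deriv u (‖z‖ ^ 2) with hadef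
  set b := deriv (deriv u) (‖z‖ ^ 2) with hbdef
  set R := ‖z‖ ^ 2 with hRdef
  obtain ⟨P₁, hP₁⟩ : ∃ P, P = (z 0).re ^ 2 + (z 1).re ^ 2 + (z 0).im ^ 2 + (z 1).im ^ 2 := ⟨_, rfl⟩
  obtain ⟨P₂, hP₂⟩ : ∃ P, P = (z 2).re ^ 2 + (z 3).re ^ 2 + (z 2).im ^ 2 + (z 3).im ^ 2 := ⟨_, rfl⟩
  obtain ⟨p₁, hp₁⟩ : ∃ p, p = (z 0).re ^ 2 + (z 1).re ^ 2 - (z 0).im ^ 2 - (z 1).im ^ 2 := ⟨_, rfl⟩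
  obtain ⟨p₂, hp₂⟩ : ∃ p, p = (z 2).re ^ 2 + (z 3).re ^ 2 - (z 2).im ^ 2 - (z 3).im ^ 2 := ⟨_, rfl⟩
  have hPp₁ : P₁ ^ 2 - p₁ ^ 2 = 4 * crossTerm z 0 1 ^ 2 := by
    rw [hP₁, hp₁, crossTerm]
    linear_combination 4 * ((z 0).re * (z 0).im + (z 1).re * (z 1).im) * hz.perp₁
  have hPp₂ : P₂ ^ 2 - p₂ ^ 2 = 4 * crossTerm z 2 3 ^ 2 := by
    rw [hP₂, hp₂, crossTerm]
    linear_combination 4 * ((z 2).re * (z 2).im + (z 3).re * (z 3).im) * hz.perp₂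
  have hpos₁ : 0 < P₁ := lt_of_le_of_ne (by rw [hP₁]; positivity) (hP₁ ▸ hz.ne₁.symm)
  have hpos₂ : 0 < P₂ := lt_of_le_of_ne (by rw [hP₂]; positivity) (hP₂ ▸ hz.ne₂.symm)
  have hzzre := congrArg Complex.re hzz
  rw [Complex.re_sum, Fin.sum_univ_seven] at hzzre
  simp only [Complex.mul_re, hz.im₄, hz.im₅, hz.im₆, Complex.one_re] at hzzre
  rw [Fin.sum_univ_seven, hz.im₄, hz.im₅, hz.im₆] at hRre
  have hG := gram_pos (p₁ := p₁) (p₂ := p₂) (E := (z 4).re ^ 2 + (z 5).re ^ 2 + (z 6).re ^ 2) ha hD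
    (by rw [hRre, hP₁, hP₂]; ring) (by rw [hp₁, hp₂]; linarith) hpos₁ hpos₂ (by positivity)
    (by nlinarith) (by nlinarith)
  have hM : (of fun i j => (Fin.cons z v : Fin 7 → CSpace 6) i j) =
      of (Fin.cons z fun k => v k : Fin 7 → Fin 7 → ℂ) := by
    ext i j
    refine Fin.cases ?_ (fun i => ?_) i <;> rfl
  rw [hM]
  -- The covectors are dz₅, dz₆, dz₇, the pairings with z in the two plane blocks, and the two
  -- rotation covectors. In the product of minors the terms quadratic in u'' cancel, leaving u'
  -- times the quantity of `gram_pos`.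
  refine im_det_eq_zero_of_real_pairings (mul_pos ha hG).ne' ((det_block_rows (z 0) (z 1) (z 2) (z 3)
    (rotationCovector a b R z 0 1) (rotationCovector a b R z 2 3)).trans ?_) fun i j => ?_
  · rw [rotationCovector_minor a b R z (by decide), rotationCovector_minor a b R z (by decide),
      rotationCovector_minor_of_ne a b R z (by decide) (by decide) (by decide) (by decide),
      rotationCovector_minor_of_ne a b R z (by decide) (by decide) (by decide) (by decide),
      ← hP₁, ← hP₂, ← Complex.ofReal_mul, ← Complex.ofReal_mul, ← Complex.ofReal_sub]
    congr 1
    rw [hPp₁, hPp₂]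
    ring
  · revert i
    refine Fin.cases ?_ (fun k => ?_)
    · have hzero (i j : Fin 7) : (z ⬝ᵥ rotationCovector a b R z i j).im = 0 := by
        rw [dotProduct_rotationCovector, ← hR, hzz, ← Complex.zero_im]
        congr 1
        ring
      refine im_dotProduct_block_rows hz.im₄ hz.im₅ hz.im₆ ?_ ?_ (hzero 0 1) (hzero 2 3) j
      · simp only [Complex.add_im, Complex.mul_im]
        linear_combination 2 * hz.perp₁
      · simp only [Complex.add_im, Complex.mul_im]
        linear_combination 2 * hz.perp₂
    · have hvk := hv k
      refine im_dotProduct_block_rows hvk.im₄ hvk.im₅ hvk.im₆ ?_ ?_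
        (im_dotProduct_rotationCovector (hzv k) hvk.moment₁)
        (im_dotProduct_rotationCovector (hzv k) hvk.moment₂) j
      · simp only [Complex.add_im, Complex.mul_im]
        linear_combination hvk.perp₁
      · simp only [Complex.add_im, Complex.mul_im]
        linear_combination hvk.perp₂

end LevelTangent

/-! ### Transfer of the level equations to the quadric, and conclusion. -/

theorem isLevelPoint_toQuadric {u : ℝ → ℝ} {c₁ c₂ : ℝ} {p : RSpace 6 × RSpace 6}
    (hp : p ∈ regularSet) (h : levelMap u c₁ c₂ p = 0) : IsLevelPoint (toQuadric p) := by
  obtain ⟨⟨h1, -⟩, ⟨h2, -⟩, -, h4, h5, h6⟩ := levelMap_eq_zero_iff.1 h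
  have hc := Real.cosh_pos ‖p.2‖
  have hr := norm_pos_iff.2 hp.1
  have hs : 0 < Real.sinh ‖p.2‖ / ‖p.2‖ := div_pos (Real.sinh_pos_iff.2 hr) hr
  have hne {x₀ x₁ ξ₀ ξ₁ k l : ℝ} (hk : 0 < k) (hl : 0 < l)
      (hx : x₀ ^ 2 + x₁ ^ 2 + ξ₀ ^ 2 + ξ₁ ^ 2 ≠ 0) :
      (k * x₀) ^ 2 + (k * x₁) ^ 2 + (l * ξ₀) ^ 2 + (l * ξ₁) ^ 2 ≠ 0 := by
    intro h0
    have h2 : k ^ 2 * (x₀ ^ 2 + x₁ ^ 2) + l ^ 2 * (ξ₀ ^ 2 + ξ₁ ^ 2) = 0 := by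
      linear_combination h0
    rw [add_eq_zero_iff_of_nonneg (by positivity) (by positivity), mul_eq_zero_iff_left (by positivity),
      mul_eq_zero_iff_left (by positivity)] at h2
    exact hx (by linear_combination h2.1 + h2.2)
  constructor
  · simp only [re_toQuadric, im_toQuadric]
    linear_combination Real.cosh ‖p.2‖ * (Real.sinh ‖p.2‖ / ‖p.2‖) * h1
  · simp only [re_toQuadric, im_toQuadric]
    linear_combination Real.cosh ‖p.2‖ * (Real.sinh ‖p.2‖ / ‖p.2‖) * h2
  · simp only [re_toQuadric, im_toQuadric]
    exact hne hc hs hp.2.1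
  · simp only [re_toQuadric, im_toQuadric]
    exact hne hc hs hp.2.2.1
  · rw [im_toQuadric, h4, mul_zero]
  · rw [im_toQuadric, h5, mul_zero]
  · rw [im_toQuadric, h6, mul_zero]

theorem hasFDerivAt_re_coord (z : CSpace 6) (i : Fin 7) :
    HasFDerivAt (fun y : CSpace 6 => (y i).re) (Complex.reCLM.comp
      ((EuclideanSpace.proj i : CSpace 6 →L[ℂ] ℂ).restrictScalars ℝ)) z :=
  (Complex.reCLM.comp ((EuclideanSpace.proj i : CSpace 6 →L[ℂ] ℂ).restrictScalars ℝ)).hasFDerivAt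

theorem hasFDerivAt_im_coord (z : CSpace 6) (i : Fin 7) :
    HasFDerivAt (fun y : CSpace 6 => (y i).im) (Complex.imCLM.comp
      ((EuclideanSpace.proj i : CSpace 6 →L[ℂ] ℂ).restrictScalars ℝ)) z :=
  (Complex.imCLM.comp ((EuclideanSpace.proj i : CSpace 6 →L[ℂ] ℂ).restrictScalars ℝ)).hasFDerivAt

theorem perp_of_tangent {S : Set (RSpace 6 × RSpace 6)} {p v : RSpace 6 × RSpace 6}
    (hv : v ∈ tangentVectors S p) {i j : Fin 7}
    (hS : ∀ q ∈ S, (toQuadric q i).re * (toQuadric q i).im +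
      (toQuadric q j).re * (toQuadric q j).im = 0) :
    (toQuadric p i).re * (fderiv ℝ toQuadric p v i).im +
      (toQuadric p i).im * (fderiv ℝ toQuadric p v i).re +
      ((toQuadric p j).re * (fderiv ℝ toQuadric p v j).im +
        (toQuadric p j).im * (fderiv ℝ toQuadric p v j).re) = 0 :=
  fderiv_toQuadric_mem_ker hv
    (((hasFDerivAt_re_coord (toQuadric p) i).fun_mul (hasFDerivAt_im_coord _ i)).fun_add
      ((hasFDerivAt_re_coord _ j).fun_mul (hasFDerivAt_im_coord _ j))) hS

theorem moment_of_tangent {u : ℝ → ℝ} {S : Set (RSpace 6 × RSpace 6)} {p v : RSpace 6 × RSpace 6}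
    (hv : v ∈ tangentVectors S p) (hu : ContDiffAt ℝ ∞ u (‖toQuadric p‖ ^ 2)) {i j : Fin 7} {a : ℝ}
    (hS : ∀ q ∈ S, deriv u (‖toQuadric q‖ ^ 2) * ((toQuadric q j).im * (toQuadric q i).re -
      (toQuadric q j).re * (toQuadric q i).im) = a) :
    deriv u (‖toQuadric p‖ ^ 2) *
      ((toQuadric p j).im * (fderiv ℝ toQuadric p v i).re +
        (toQuadric p i).re * (fderiv ℝ toQuadric p v j).im -
        ((toQuadric p j).re * (fderiv ℝ toQuadric p v i).im +
          (toQuadric p i).im * (fderiv ℝ toQuadric p v j).re)) +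
      ((toQuadric p j).im * (toQuadric p i).re - (toQuadric p j).re * (toQuadric p i).im) *
        (deriv (deriv u) (‖toQuadric p‖ ^ 2) *
          (2 * inner ℝ (toQuadric p) (fderiv ℝ toQuadric p v))) = 0 := by
  have hd' : HasDerivAt (deriv u) (deriv (deriv u) (‖toQuadric p‖ ^ 2)) (‖toQuadric p‖ ^ 2) :=
    ((contDiffAt_deriv hu).differentiableAt (by simp)).hasDerivAt
  have hd : HasFDerivAt (fun y : CSpace 6 => deriv u (‖y‖ ^ 2))
      (deriv (deriv u) (‖toQuadric p‖ ^ 2) • (2 • innerSL ℝ (toQuadric p))) (toQuadric p) :=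
    HasDerivAt.comp_hasFDerivAt (h₂ := deriv u) (f := fun y : CSpace 6 => ‖y‖ ^ 2) (toQuadric p) hd'
      (hasStrictFDerivAt_norm_sq (toQuadric p)).hasFDerivAt
  have h := fderiv_toQuadric_mem_ker hv
    (hd.fun_mul (((hasFDerivAt_im_coord (toQuadric p) j).fun_mul (hasFDerivAt_re_coord _ i)).fun_sub
      ((hasFDerivAt_re_coord _ j).fun_mul (hasFDerivAt_im_coord _ i)))) hS
  simp only [add_apply, sub_apply, smul_apply, smul_eq_mul, nsmul_eq_mul, Nat.cast_ofNat,
    innerSL_apply_apply] at h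
  exact h

theorem isLevelTangent_fderiv {c : ℝ} {u : ℝ → ℝ} (hu : IsStenzelPotential 6 c u) {c₁ c₂ : ℝ}
    {S : Set (RSpace 6 × RSpace 6)} (hS : S = {p ∈ regularSet | levelMap u c₁ c₂ p = 0})
    {p v : RSpace 6 × RSpace 6} (hp : p ∈ S) (hv : v ∈ tangentVectors S p) :
    IsLevelTangent (deriv u (‖toQuadric p‖ ^ 2)) (deriv (deriv u) (‖toQuadric p‖ ^ 2)) (toQuadric p)
      (fderiv ℝ toQuadric p v) := by
  have hpt : ∀ q ∈ S, IsLevelPoint (toQuadric q) := fun q hq => by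
    rw [hS] at hq
    exact isLevelPoint_toQuadric hq.1 hq.2
  have hnorm : ∀ q ∈ S, ‖q.1‖ = 1 := fun q hq => by
    rw [hS] at hq
    exact (levelMap_eq_zero_iff.1 hq.2).2.2.1
  have hsm : ContDiffAt ℝ ∞ u (‖toQuadric p‖ ^ 2) := by
    rw [normSq_toQuadric (hnorm p hp)]
    exact hu.smooth _ (Real.one_le_cosh _)
  -- The moment component is -2 u'(r²) Im(z_j conj z_i), whence the constant -a/2.
  have hmom {i j : Fin 7} {a : ℝ} (h : ∀ q ∈ S, momentFactor u ‖q.2‖ *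
      (q.1 i * q.2 j - q.1 j * q.2 i) = a) : ∀ q ∈ S, deriv u (‖toQuadric q‖ ^ 2) *
      ((toQuadric q j).im * (toQuadric q i).re - (toQuadric q j).re * (toQuadric q i).im) =
        -a / 2 := fun q hq => by
    rw [← h q hq, ← momentMap_eq_momentFactor u (hnorm q hq), momentMap_rotationGenerator]
    ring
  have him {i : Fin 7} (h : ∀ q ∈ S, (toQuadric q i).im = 0) :
      (fderiv ℝ toQuadric p v i).im = 0 :=
    fderiv_toQuadric_mem_ker hv (hasFDerivAt_im_coord _ i) h
  constructor
  · exact perp_of_tangent hv fun q hq => (hpt q hq).perp₁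
  · exact perp_of_tangent hv fun q hq => (hpt q hq).perp₂
  · exact moment_of_tangent hv hsm (hmom (a := c₁) fun q hq =>
      (levelMap_eq_zero_iff.1 (hS ▸ hq : q ∈ {p ∈ regularSet | levelMap u c₁ c₂ p = 0}).2).1.2)
  · exact moment_of_tangent hv hsm (hmom (a := c₂) fun q hq =>
      (levelMap_eq_zero_iff.1 (hS ▸ hq : q ∈ {p ∈ regularSet | levelMap u c₁ c₂ p = 0}).2).2.1.2)
  · exact him fun q hq => (hpt q hq).im₄
  · exact him fun q hq => (hpt q hq).im₅
  · exact him fun q hq => (hpt q hq).im₆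

theorem isSpecialLagrangian_sweep_principalLevel {c : ℝ} {u : ℝ → ℝ}
    (hu : IsStenzelPotential 6 c u) (hc : 0 < c) {c₁ c₂ : ℝ} (h : (c₁, c₂) ≠ (0, 0)) :
    IsSpecialLagrangian c u (sweep (principalLevel u c₁ c₂)) := by
  have hS := sweep_principalLevel (u := u) h
  have hmem : ∀ q ∈ sweep (principalLevel u c₁ c₂), q ∈ regularSet ∧ levelMap u c₁ c₂ q = 0 :=
    fun q hq => by rwa [hS] at hq
  have hsub : sweep (principalLevel u c₁ c₂) ⊆ cotangentSphere 6 := fun q hq => by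
    obtain ⟨⟨h1, -⟩, ⟨h2, -⟩, h3, h4, h5, h6⟩ := levelMap_eq_zero_iff.1 (hmem q hq).2
    refine ⟨h3, ?_⟩
    rw [inner_eq_sum, Fin.sum_univ_seven, h4, h5, h6]
    linear_combination h1 + h2
  have hpt := fun q hq => isLevelPoint_toQuadric (hmem q hq).1 (hmem q hq).2
  refine isSpecialLagrangian_of_im_eq_zero hu hc (by norm_num) hsub
    (isSubmanifold_sweep_principalLevel hu hc h) (fun p hp v hv w hw => ?_) fun p hp v hv => ?_
  · exact im_kahlerPairing_eq_zero (hpt p hp) (isLevelTangent_fderiv hu hS hp hv)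
      (isLevelTangent_fderiv hu hS hp hw)
  · have hma := hu.monge_ampere hc (by norm_num) (t := 2 * ‖p.2‖) (by positivity)
    rw [← normSq_toQuadric (hsub hp).1] at hma
    refine im_det_eq_zero_of_isLevelTangent (hpt p hp) (sum_toQuadric_mul_self (hsub hp))
      (fun k => sum_toQuadric_mul_fderiv hsub (hv k)) hma.1
      (pos_of_mul_pos_right (hma.2 ▸ hc) (pow_nonneg hma.1.le _))
      fun k => isLevelTangent_fderiv hu hS hp (hv k)

theorem areDiffeomorphic_conormalBundle_greatSphere {I : Finset (Fin 7)} {k : ℕ}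
    (σ : Equiv.Perm (Fin 7)) (h : ∀ i : Fin 7, k < (i : ℕ) ↔ σ i ∈ I) :
    AreDiffeomorphic (coordinateConormal I) (conormalBundle (greatSphere 6 k)) := by
  rw [conormalBundle_greatSphere]
  exact areDiffeomorphic_coordinateConormal fun i => by
    rw [Finset.mem_filter, ← h]
    simp

end Stenzel

theorem proposition5p4 (c : ℝ) (hc : 0 < c) (u : ℝ → ℝ)
    (hu : Stenzel.IsStenzelPotential 6 c u) :
    (∃ A ∈ Stenzel.groupH, ∃ B ∈ Stenzel.groupH, A * B ≠ B * A) ∧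
    (∀ c₁ c₂ : ℝ, (c₁, c₂) ≠ (0, 0) → (Stenzel.principalLevel u c₁ c₂).Nonempty →
      Stenzel.IsSpecialLagrangian c u (Stenzel.sweep (Stenzel.principalLevel u c₁ c₂))) ∧
    (Stenzel.sweep (Stenzel.fullLevel u 0 0) =
        Stenzel.sweep Stenzel.pieceSphere ∪
        Stenzel.sweep Stenzel.pieceCylinderOne ∪ Stenzel.sweep Stenzel.pieceCylinderThree ∪
        Stenzel.sweep (Stenzel.piecePlane 1) ∪ Stenzel.sweep (Stenzel.piecePlane (-1))) ∧
    (IsConnected (Stenzel.sweep Stenzel.pieceSphere) ∧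
      Stenzel.IsSpecialLagrangian c u (Stenzel.sweep Stenzel.pieceSphere) ∧
      Stenzel.AreDiffeomorphic (Stenzel.sweep Stenzel.pieceSphere)
        (Metric.sphere (0 : EuclideanSpace ℝ (Fin 7)) 1)) ∧
    (∀ S ∈ ({Stenzel.pieceCylinderOne, Stenzel.pieceCylinderThree} :
        Set (Set (Stenzel.RSpace 6 × Stenzel.RSpace 6))),
      IsConnected (Stenzel.sweep S) ∧ Stenzel.IsSpecialLagrangian c u (Stenzel.sweep S) ∧
      Stenzel.AreDiffeomorphic (Stenzel.sweep S)
        (Stenzel.conormalBundle (Stenzel.greatSphere 6 4))) ∧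
    (∀ ε ∈ ({1, -1} : Set ℝ),
      IsConnected (Stenzel.sweep (Stenzel.piecePlane ε)) ∧
      Stenzel.IsSpecialLagrangian c u (Stenzel.sweep (Stenzel.piecePlane ε)) ∧
      Stenzel.AreDiffeomorphic (Stenzel.sweep (Stenzel.piecePlane ε))
        (Stenzel.conormalBundle (Stenzel.greatSphere 6 2))) := by
  have hu6 : (6 : ℕ) ≠ 0 := by norm_num
  refine ⟨Stenzel.groupH_noncommutative,
    fun c₁ c₂ h _ => Stenzel.isSpecialLagrangian_sweep_principalLevel hu hc h, ?_, ?_, ?_, ?_⟩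
  · rw [Stenzel.fullLevel_zero hu hc]
    simp only [Stenzel.sweep_union]
  · rw [Stenzel.sweep_pieceSphere]
    exact ⟨Stenzel.isConnected_coordinateConormal (by decide),
      Stenzel.isSpecialLagrangian_coordinateConormal hu hc hu6 (by decide),
      Stenzel.areDiffeomorphic_coordinateConormal_empty⟩
  · rintro S (rfl | rfl)
    · rw [Stenzel.sweep_pieceCylinderOne]
      exact ⟨Stenzel.isConnected_coordinateConormal (by decide),
        Stenzel.isSpecialLagrangian_coordinateConormal hu hc hu6 (by decide),
        -- A cyclic shift by 2 carries the indices 5, 6 to 0, 1; below, a shift by 4 carries 5, 6 to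
        -- 2, 3 and 3, …, 6 to 0, …, 3.
        Stenzel.areDiffeomorphic_conormalBundle_greatSphere (finRotate 7 ^ 2) (by decide)⟩
    · rw [Stenzel.sweep_pieceCylinderThree]
      exact ⟨Stenzel.isConnected_coordinateConormal (by decide),
        Stenzel.isSpecialLagrangian_coordinateConormal hu hc hu6 (by decide),
        Stenzel.areDiffeomorphic_conormalBundle_greatSphere (finRotate 7 ^ 4) (by decide)⟩
  · intro ε hε
    have hε' : ε ^ 2 = 1 := by
      rcases hε with rfl | rfl <;> norm_num
    rw [Stenzel.sweep_piecePlane hε']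
    exact ⟨Stenzel.isConnected_coordinateConormal (by decide),
      Stenzel.isSpecialLagrangian_coordinateConormal hu hc hu6 (by decide),
      Stenzel.areDiffeomorphic_conormalBundle_greatSphere (finRotate 7 ^ 4) (by decide)⟩
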